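/- **Setup.** Let $V=(X,(Z_\jmath)_{\jmath\le\mathcal J})$ take values in $\mathbf R^{d_x}\times\prod_\jmath\mathbf R^{d_{z_\jmath}}$, let $\mathbf P$ be a set of distributions of $V$, let $\mathbf B$ be a Banach space, $\Theta\subseteq\mathbf B$, $R\subseteq\mathbf B$, and let $\rho_\jmath(x,\theta)$, $1\le\jmath\le\mathcal J$, be real functions that are measurable in $x$ for each $\theta\in\Theta$. Set $\Theta_0(P)=\{\theta\in\Theta: E_P[\rho_\jmath(X,\theta)|Z_\jmath]=0,\ 1\le\jmath\le\mathcal J\}$ and $\mathbf P_0=\{P\in\mathbf P:\Theta_0(P)\cap R\ne\emptyset\}$. The sieves satisfy $\Theta_n\cap R\subseteq\Theta$; $\mathbf B_n$ is the $\|\cdot\|_{\mathbf B}$-closure of the linear span of $\Theta_n\cap R$. For measurable transformations $q_{k,n,\jmath}$, $1\le k\le k_{n,\jmath}$, let $k_n=\sum_\jmath k_{n,\jmath}$ and let $\rho(x,\theta)*q_n^{k_n}(z)\in\mathbf R^{k_n}$ be the vector with entries $\rho_\jmath(x,\theta)q_{k,n,\jmath}(z_\jmath)$; assume $k_n\ge2$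 for all large $n$. Fix $r\in[2,\infty]$ (with $1/\infty=0$), and let $\|\cdot\|_r$ be the $\ell^r$ norm and $\|\cdot\|_{o,r}$ the induced operator norm on square matrices. With $\hat\Sigma_n$ a random positive definite $k_n\times k_n$ matrix, let $$Q_n(\theta)=\Big\|\hat\Sigma_n\frac1{\sqrt n}\sum_{i=1}^n\rho(X_i,\theta)*q_n^{k_n}(Z_i)\Big\|_r,\qquad m_{n,P}(\theta)=\|E_P[\rho(X,\theta)*q_n^{k_n}(Z)]\|_r .$$ For a sequence $\tau_n\ge0$ let $$\hat\Theta_n\cap R=\{\theta\in\Theta_n\cap R:\tfrac1{\sqrt n}Q_n(\theta)\le\inf_{\Theta_n\cap R}\tfrac1{\sqrt n}Q_n+\tau_n\},\qquad \Theta_{0n}(P)\cap R=\arg\min_{\theta\in\Theta_n\cap R}m_{n,P}(\theta).$$ Let $\vec d_H(A,B,\|\cdot\|)=\sup_{a\in A}\inf_{b\in B}\|a-b\|$ and $d_H(A,B,\|\cdot\|)=\max\{\vec d_H(A,B,\|\cdot\|),\vec d_H(B,A,\|\cdot\|)\}$, with values in $[0,\infty]$. Further let $(\Theta_{0n}(P)\cap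 R)^\epsilon=\{\theta\in\Theta_n\cap R:\vec d_H(\{\theta\},\Theta_{0n}(P)\cap R,\|\cdot\|_{\mathbf B})<\epsilon\}$ and $$S_n(\epsilon)=\inf_{P\in\mathbf P_0}\ \inf_{\theta\in(\Theta_n\cap R)\setminus(\Theta_{0n}(P)\cap R)^\epsilon}m_{n,P}(\theta)\qquad(\inf\emptyset=\infty).$$ Let $\mathcal F_n=\{\rho_\jmath(\cdot,\theta):\theta\in\Theta_n\cap R,\ 1\le\jmath\le\mathcal J\}$ and $J_{[\,]}(\delta,\mathcal F_n,\|\cdot\|_{L^2_P})=\int_0^\delta\sqrt{1+\log N_{[\,]}(\epsilon,\mathcal F_n,\|\cdot\|_{L^2_P})}\,d\epsilon$, with $N_{[\,]}$ the $L^2_P$ bracketing numbers. Probabilities of possibly non-measurable events are outer probabilities. **Assumptions.** 1. For each $P\in\mathbf P$, $V_1,V_2,\dots$ are i.i.d. with distribution $P$. 2. $\|q_{k,n,\jmath}\|_{L^\infty_P}\le B_n$ for all $k,\jmath,n$ and $P\in\mathbf P$, where $B_n\ge1$. 3. For each $n$ the class $\mathcal F_n$ is closed in $L^2_P$ for every $P\in\mathbf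 P$, has a measurable envelope $F_n$ with $\sup_{P\in\mathbf P}E_P[F_n^2]<\infty$, and satisfies $\sup_{P\in\mathbf P}J_{[\,]}(\|F_n\|_{L^2_P},\mathcal F_n,\|\cdot\|_{L^2_P})\le J_n<\infty$. 4. There are positive definite (hence invertible) matrices $\Sigma_n(P)$ with $\|\Sigma_n(P)\|_{o,r}$ and $\|\Sigma_n(P)^{-1}\|_{o,r}$ bounded uniformly in $n$ and $P\in\mathbf P$, and $\|\hat\Sigma_n-\Sigma_n(P)\|_{o,r}=o_p(1)$ uniformly in $P\in\mathbf P$. 5. $\sup_{P\in\mathbf P_0}\inf_{\theta\in\Theta_n\cap R}m_{n,P}(\theta)\le\zeta_n$ with $0\le\zeta_n\to0$, and $\zeta_n+k_n^{1/r}\sqrt{\log k_n}J_nB_n/\sqrt n=o(S_n(\epsilon))$ for every $\epsilon>0$. 6. (Local identification.) $\mathbf E$ is a Banach space with $\mathbf B_n\subseteq\mathbf E$ (as a linear subspace) for all $n$, and there are $\epsilon>0$ and $\nu_n>0$ with $\nu_n^{-1}=O(1)$ such that, with a remainder $O(\zeta_n)$ that does not depend on $P$ and $\theta$, $$\nu_n^{-1}\,\vec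 d_H(\{\theta\},\Theta_{0n}(P)\cap R,\|\cdot\|_{\mathbf E})\le m_{n,P}(\theta)+O(\zeta_n)\quad\text{for all }P\in\mathbf P_0,\ \theta\in(\Theta_{0n}(P)\cap R)^\epsilon .$$ **Theorem.** Let $\mathcal R_n=\nu_n\Big\{\dfrac{k_n^{1/r}\sqrt{\log k_n}\,J_nB_n}{\sqrt n}+\zeta_n\Big\}$, and let $\tau_n=o(S_n(\epsilon))$ for every $\epsilon>0$. Then (i) uniformly in $P\in\mathbf P_0$, $\ \vec d_H(\hat\Theta_n\cap R,\Theta_{0n}(P)\cap R,\|\cdot\|_{\mathbf E})=O_p(\mathcal R_n+\nu_n\tau_n)$; (ii) if in addition $\dfrac{k_n^{1/r}\sqrt{\log k_n}\,J_nB_n}{\sqrt n}+\zeta_n=o(\tau_n)$, then uniformly in $P\in\mathbf P_0$, $\ d_H(\hat\Theta_n\cap R,\Theta_{0n}(P)\cap R,\|\cdot\|_{\mathbf E})=O_p(\mathcal R_n+\nu_n\tau_n)$. Here $X_{n,P}=O_p(a_n)$ uniformly in $P\in\mathbf P_0$ means: for every $\varepsilon>0$ there is $M<\infty$ with $\sup_{P\in\mathbf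 P_0}P(X_{n,P}>Ma_n)\le\varepsilon$ for all large $n$. -/

import Mathlib

open MeasureTheory ProbabilityTheory Filter Topology Asymptotics
open scoped ENNReal Matrix

noncomputable section

/-! ### Norms and distances -/

/-- The `ℓ^r` norm of a vector, `r ∈ [1, ∞]` (the maximum norm when `r = ∞`). -/
def vecNorm {ι : Type*} [Fintype ι] (r : ℝ≥0∞) (a : ι → ℝ) : ℝ :=
  ‖(WithLp.toLp r a : PiLp r fun _ : ι => ℝ)‖

/-- The operator norm `‖A‖_{o,r} = sup {‖A a‖_r : ‖a‖_r = 1}` of a square matrix. -/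
def matNorm {ι : Type*} [Fintype ι] (r : ℝ≥0∞) (A : Matrix ι ι ℝ) : ℝ :=
  sSup {t : ℝ | ∃ a : ι → ℝ, vecNorm r a = 1 ∧ t = vecNorm r (A *ᵥ a)}

/-- Directed Hausdorff distance `sup_{a ∈ A} inf_{b ∈ B} ‖a - b‖`, with values in `[0, ∞]`. -/
def dirHausdorff {E : Type*} [NormedAddCommGroup E] (A B : Set E) : ℝ≥0∞ :=
  ⨆ a ∈ A, ⨅ b ∈ B, ENNReal.ofReal ‖a - b‖

/-- Hausdorff distance: the maximum of the two directed distances. -/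
def hausdorff {E : Type*} [NormedAddCommGroup E] (A B : Set E) : ℝ≥0∞ :=
  max (dirHausdorff A B) (dirHausdorff B A)

/-! ### Bracketing -/

/-- `N_[](ε, 𝓕, ‖·‖_{L²_P})`: the smallest number of `L²(P)` brackets `[L, U]` with
`‖U - L‖_{L²_P} < ε` that cover `𝓕` (`⊤` if no finite number does). -/
def bracketNumber {α : Type*} [MeasurableSpace α] (P : Measure α) (𝓕 : Set (α → ℝ)) (ε : ℝ) :
    ℕ∞ :=
  ⨅ (m : ℕ) (_ : ∃ L U : Fin m → α → ℝ,
      (∀ i, MemLp (L i) 2 P ∧ MemLp (U i) 2 P ∧ eLpNorm (U i - L i) 2 P < ENNReal.ofReal ε) ∧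
      ∀ f ∈ 𝓕, ∃ i, ∀ v, L i v ≤ f v ∧ f v ≤ U i v), (m : ℕ∞)

/-- `J_[](δ, 𝓕, ‖·‖_{L²_P}) = ∫_0^δ (1 + log N_[](ε, 𝓕, ‖·‖_{L²_P}))^{1/2} dε`, in `[0, ∞]`. -/
def bracketIntegral {α : Type*} [MeasurableSpace α] (P : Measure α) (𝓕 : Set (α → ℝ)) (δ : ℝ) :
    ℝ≥0∞ :=
  ∫⁻ ε in Set.Ioo 0 δ,
    (1 + (ENNReal.log (bracketNumber P 𝓕 ε : ℝ≥0∞)).toENNReal) ^ (1 / 2 : ℝ)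

/-! ### Asymptotic order -/

/-- `a_n = o(S_n)` for real `a_n ≥ 0` and `S_n ∈ [0, ∞]`. -/
def IsLittleOExt (a : ℕ → ℝ) (S : ℕ → ℝ≥0∞) : Prop :=
  ∀ c : ℝ, 0 < c → ∀ᶠ n in atTop, ENNReal.ofReal (a n) ≤ ENNReal.ofReal c * S n

/-- `X_{n,p} = O_p(a_n)` uniformly in `p ∈ s`, where `X_{n,p} ≥ 0` is random under `Pr p`.
On non-measurable events `Pr p` is the outer probability. -/
def UniformBigOp {ι Ω : Type*} [MeasurableSpace Ω] (s : Set ι) (Pr : ι → Measure Ω)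
    (X : ℕ → ι → Ω → ℝ≥0∞) (a : ℕ → ℝ) : Prop :=
  ∀ ε : ℝ, 0 < ε → ∃ M : ℝ, 0 < M ∧ ∀ᶠ n in atTop,
    (⨆ p ∈ s, Pr p {ω | ENNReal.ofReal (M * a n) < X n p ω}) ≤ ENNReal.ofReal ε

/-! ### The conditional moment restriction model -/

/-- The space of the observations `V = (X, (Z_1, …, Z_𝒥))`. -/
abbrev Obs (𝒥 dx : ℕ) (dz : Fin 𝒥 → ℕ) : Type :=
  (Fin dx → ℝ) × (∀ j : Fin 𝒥, Fin (dz j) → ℝ)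

/-- The primitives of the model and of the criterion function. -/
structure SieveModel (𝒥 dx : ℕ) (dz : Fin 𝒥 → ℕ) (𝓑 Ω : Type*) [NormedAddCommGroup 𝓑]
    [NormedSpace ℝ 𝓑] [MeasurableSpace Ω] where
  /-- The parameter space. -/
  Θ : Set 𝓑
  /-- The restriction set. -/
  R : Set 𝓑
  /-- The sets `Θ_n`; the sieve is `Θ_n ∩ R`. -/
  Θs : ℕ → Set 𝓑
  sieve_subset : ∀ n, Θs n ∩ R ⊆ Θ
  /-- The generalized residuals `ρ_j(x, θ)`; only their values at `θ ∈ Θ` matter. -/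
  ρ : Fin 𝒥 → (Fin dx → ℝ) → 𝓑 → ℝ
  measurable_ρ : ∀ j, ∀ θ ∈ Θ, Measurable fun x => ρ j x θ
  /-- The number `k_{n,j}` of transformations of the `j`-th instrument. -/
  k : ℕ → Fin 𝒥 → ℕ
  /-- The transformations `q_{k,n,j}`. -/
  q : ∀ (n : ℕ) (j : Fin 𝒥), Fin (k n j) → (Fin (dz j) → ℝ) → ℝ
  measurable_q : ∀ n j i, Measurable (q n j i)
  /-- The exponent of the norm in the criterion function. -/
  r : ℝ≥0∞
  two_le_r : 2 ≤ r
  /-- The set of distributions under consideration. -/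
  Pcl : Set (ProbabilityMeasure (Obs 𝒥 dx dz))
  /-- The probability on the sample space when the observations have distribution `P`. -/
  Pr : ProbabilityMeasure (Obs 𝒥 dx dz) → Measure Ω
  /-- The observations; the sample of size `n` is `V 0, …, V (n - 1)`. -/
  V : ℕ → Ω → Obs 𝒥 dx dz
  /-- The random weighting matrix. -/
  Wt : ∀ n : ℕ, Ω → Matrix (Σ j, Fin (k n j)) (Σ j, Fin (k n j)) ℝ
  posDef_Wt : ∀ n ω, (Wt n ω).PosDef

namespace SieveModel

variable {𝒥 dx : ℕ} {dz : Fin 𝒥 → ℕ} {𝓑 Ω : Type*} [NormedAddCommGroup 𝓑]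
  [NormedSpace ℝ 𝓑] [MeasurableSpace Ω] (M : SieveModel 𝒥 dx dz 𝓑 Ω)

/-- The sieve `Θ_n ∩ R`. -/
def sieve (n : ℕ) : Set 𝓑 := M.Θs n ∩ M.R

/-- The subspace `𝐁_n`: the closure of the linear span of `Θ_n ∩ R`. -/
def sieveSpan (n : ℕ) : Submodule ℝ 𝓑 := (Submodule.span ℝ (M.sieve n)).topologicalClosure

/-- The identified set `Θ_0(P)`: all `θ ∈ Θ` with `E_P[ρ_j(X, θ) | Z_j] = 0` for every `j`. -/
def identifiedSet (P : ProbabilityMeasure (Obs 𝒥 dx dz)) : Set 𝓑 :=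
  {θ | θ ∈ M.Θ ∧ ∀ j : Fin 𝒥,
    Integrable (fun v : Obs 𝒥 dx dz => M.ρ j v.1 θ) (P : Measure (Obs 𝒥 dx dz)) ∧
    condExp (MeasurableSpace.comap (fun v : Obs 𝒥 dx dz => v.2 j) inferInstance)
      (P : Measure (Obs 𝒥 dx dz)) (fun v => M.ρ j v.1 θ)
      =ᵐ[(P : Measure (Obs 𝒥 dx dz))] 0}

/-- `𝐏_0`: the distributions in `𝐏` that satisfy the null hypothesis. -/
def nullSet : Set (ProbabilityMeasure (Obs 𝒥 dx dz)) :=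
  {P | P ∈ M.Pcl ∧ (M.identifiedSet P ∩ M.R).Nonempty}

/-- The total number `k_n` of transformations. -/
def numMoments (n : ℕ) : ℕ := ∑ j, M.k n j

/-- The vector `ρ(x, θ) * q_n^{k_n}(z)`. -/
def moment (n : ℕ) (θ : 𝓑) (v : Obs 𝒥 dx dz) : (Σ j, Fin (M.k n j)) → ℝ :=
  fun i => M.ρ i.1 v.1 θ * M.q n i.1 i.2 (v.2 i.1)

/-- The population criterion `‖E_P[ρ(X, θ) * q_n^{k_n}(Z)]‖_r`. -/
def popCrit (P : ProbabilityMeasure (Obs 𝒥 dx dz)) (n : ℕ) (θ : 𝓑) : ℝ :=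
  vecNorm M.r fun i => ∫ v, M.moment n θ v i ∂(P : Measure (Obs 𝒥 dx dz))

/-- The sample criterion `Q_n(θ) = ‖Σ̂_n n^{-1/2} ∑_{i ≤ n} ρ(X_i, θ) * q_n^{k_n}(Z_i)‖_r`. -/
def sampleCrit (n : ℕ) (ω : Ω) (θ : 𝓑) : ℝ :=
  vecNorm M.r
    (M.Wt n ω *ᵥ ((Real.sqrt n)⁻¹ • ∑ i ∈ Finset.range n, M.moment n θ (M.V i ω)))

/-- The set estimator `Θ̂_n ∩ R` of near minimizers of the sample criterion on the sieve. -/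
def setEst (τ : ℕ → ℝ) (n : ℕ) (ω : Ω) : Set 𝓑 :=
  {θ | θ ∈ M.sieve n ∧ (Real.sqrt n)⁻¹ * M.sampleCrit n ω θ ≤
    (⨅ θ' : M.sieve n, (Real.sqrt n)⁻¹ * M.sampleCrit n ω θ') + τ n}

/-- `Θ_{0n}(P) ∩ R`: the minimizers of the population criterion on the sieve. -/
def popArgmin (P : ProbabilityMeasure (Obs 𝒥 dx dz)) (n : ℕ) : Set 𝓑 :=
  {θ | θ ∈ M.sieve n ∧ ∀ θ' ∈ M.sieve n, M.popCrit P n θ ≤ M.popCrit P n θ'}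

/-- The neighbourhood `(Θ_{0n}(P) ∩ R)^ε` of `Θ_{0n}(P) ∩ R` in the sieve. -/
def nbhd (P : ProbabilityMeasure (Obs 𝒥 dx dz)) (n : ℕ) (ε : ℝ) : Set 𝓑 :=
  {θ | θ ∈ M.sieve n ∧ dirHausdorff {θ} (M.popArgmin P n) < ENNReal.ofReal ε}

/-- `S_n(ε)`, with values in `[0, ∞]` (infima over empty sets are `∞`). -/
def separation (n : ℕ) (ε : ℝ) : ℝ≥0∞ :=
  ⨅ P ∈ M.nullSet, ⨅ θ ∈ M.sieve n \ M.nbhd P n ε, ENNReal.ofReal (M.popCrit P n θ)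

/-- The class `𝓕_n` of the functions `ρ_j(·, θ)`, `θ ∈ Θ_n ∩ R`, as functions of `v`. -/
def residualClass (n : ℕ) : Set (Obs 𝒥 dx dz → ℝ) :=
  {f | ∃ j : Fin 𝒥, ∃ θ ∈ M.sieve n, f = fun v => M.ρ j v.1 θ}

/-- The sampling rate `k_n^{1/r} (log k_n)^{1/2} J_n B_n / n^{1/2}`. -/
def sampleRate (J B : ℕ → ℝ) (n : ℕ) : ℝ :=
  (M.numMoments n : ℝ) ^ (1 / M.r).toReal * Real.sqrt (Real.log (M.numMoments n)) * J n * B n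
    / Real.sqrt n

/-- `𝓡_n = ν_n (k_n^{1/r} (log k_n)^{1/2} J_n B_n / n^{1/2} + ζ_n)`. -/
def rate (J B ζ ν : ℕ → ℝ) (n : ℕ) : ℝ := ν n * (M.sampleRate J B n + ζ n)

/-! ### Assumptions -/

/-- For every `P ∈ 𝐏` the observations are i.i.d. with distribution `P`. -/
def IIDSampling : Prop :=
  (∀ i, Measurable (M.V i)) ∧
  ∀ P ∈ M.Pcl, IsProbabilityMeasure (M.Pr P) ∧ iIndepFun M.V (M.Pr P) ∧
    ∀ i, (M.Pr P).map (M.V i) = (P : Measure (Obs 𝒥 dx dz))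

/-- The transformations are bounded: `sup_k sup_{P ∈ 𝐏} ‖q_{k,n,j}‖_{L^∞_P} ≤ B_n`, `B_n ≥ 1`. -/
def BoundedInstruments (B : ℕ → ℝ) : Prop :=
  ∀ n, 1 ≤ n → 1 ≤ B n ∧ ∀ j i, ∀ P ∈ M.Pcl,
    eLpNorm (fun v : Obs 𝒥 dx dz => M.q n j i (v.2 j)) ⊤ (P : Measure (Obs 𝒥 dx dz))
      ≤ ENNReal.ofReal (B n)

/-- The classes `𝓕_n` are closed in `L²_P`, have an envelope `F_n` with
`sup_{P ∈ 𝐏} E_P[F_n²] < ∞`, and `sup_{P ∈ 𝐏} J_[](‖F_n‖_{L²_P}, 𝓕_n, ‖·‖_{L²_P}) ≤ J_n`. -/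
def ProcessRegular (J : ℕ → ℝ) : Prop :=
  (∀ n, 1 ≤ n → ∀ P ∈ M.Pcl, IsClosed {g : Lp ℝ 2 (P : Measure (Obs 𝒥 dx dz)) |
    ∃ f ∈ M.residualClass n, g =ᵐ[(P : Measure (Obs 𝒥 dx dz))] f}) ∧
  ∃ F : ℕ → Obs 𝒥 dx dz → ℝ, ∀ n, 1 ≤ n →
    Measurable (F n) ∧ (∀ f ∈ M.residualClass n, ∀ v, |f v| ≤ F n v) ∧
    (⨆ P ∈ M.Pcl, ∫⁻ v, ENNReal.ofReal (F n v ^ 2) ∂(P : Measure (Obs 𝒥 dx dz))) < ⊤ ∧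
    0 ≤ J n ∧
    ∀ P ∈ M.Pcl, bracketIntegral (P : Measure (Obs 𝒥 dx dz)) (M.residualClass n)
      (eLpNorm (F n) 2 (P : Measure (Obs 𝒥 dx dz))).toReal ≤ ENNReal.ofReal (J n)

/-- `‖Σ̂_n - Σ_n(P)‖_{o,r} = o_p(1)` uniformly in `P ∈ 𝐏`, for positive definite invertible
matrices `Σ_n(P)` that are bounded together with their inverses, uniformly in `n` and `P`. -/
def WeightsConverge : Prop :=
  ∃ S : ∀ n : ℕ, ProbabilityMeasure (Obs 𝒥 dx dz) →
      Matrix (Σ j, Fin (M.k n j)) (Σ j, Fin (M.k n j)) ℝ,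
    (∀ ε : ℝ, 0 < ε → Tendsto
      (fun n => ⨆ P ∈ M.Pcl, M.Pr P {ω | ε < matNorm M.r (M.Wt n ω - S n P)}) atTop (𝓝 0)) ∧
    (∀ n, 1 ≤ n → ∀ P ∈ M.Pcl, (S n P).PosDef ∧ IsUnit (S n P)) ∧
    ∃ C : ℝ, ∀ n, 1 ≤ n → ∀ P ∈ M.Pcl,
      matNorm M.r (S n P) ≤ C ∧ matNorm M.r (S n P)⁻¹ ≤ C

/-- `sup_{P ∈ 𝐏_0} inf_{θ ∈ Θ_n ∩ R} ‖E_P[ρ * q]‖_r ≤ ζ_n → 0`, and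
`ζ_n + k_n^{1/r} (log k_n)^{1/2} J_n B_n / n^{1/2} = o(S_n(ε))` for every `ε > 0`. -/
def Separated (J B ζ : ℕ → ℝ) : Prop :=
  (∀ n, 1 ≤ n → 0 ≤ ζ n) ∧ Tendsto ζ atTop (𝓝 0) ∧
  (∀ n, 1 ≤ n →
    (⨆ P ∈ M.nullSet, ⨅ θ ∈ M.sieve n, ENNReal.ofReal (M.popCrit P n θ))
      ≤ ENNReal.ofReal (ζ n)) ∧
  ∀ ε : ℝ, 0 < ε → IsLittleOExt (fun n => ζ n + M.sampleRate J B n) fun n => M.separation n ε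

variable {𝓔 : Type*} [NormedAddCommGroup 𝓔] [NormedSpace ℝ 𝓔]

/-- A subset of `𝐁_n` regarded as a subset of `𝐄` through `ι n : 𝐁_n → 𝐄`. -/
def toE (ι : ∀ n, M.sieveSpan n →ₗ[ℝ] 𝓔) (n : ℕ) (A : Set 𝓑) : Set 𝓔 :=
  ι n '' {b : M.sieveSpan n | (b : 𝓑) ∈ A}

/-- Local identification: `𝐁_n ⊆ 𝐄` (as linear spaces, through `ι n`), `ν_n > 0` with
`ν_n⁻¹ = O(1)`, and for some `ε > 0` and some `e_n = O(ζ_n)`,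
`ν_n⁻¹ d⃗_H({θ}, Θ_{0n}(P) ∩ R, ‖·‖_𝐄) ≤ ‖E_P[ρ * q]‖_r + e_n`
for all `P ∈ 𝐏_0` and `θ ∈ (Θ_{0n}(P) ∩ R)^ε`. -/
def LocallyIdentified (ι : ∀ n, M.sieveSpan n →ₗ[ℝ] 𝓔) (ζ ν : ℕ → ℝ) : Prop :=
  (∀ n, Function.Injective (ι n)) ∧
  (∀ n, 1 ≤ n → 0 < ν n) ∧ (fun n => (ν n)⁻¹) =O[atTop] (fun _ => (1 : ℝ)) ∧
  ∃ ε : ℝ, 0 < ε ∧ ∃ e : ℕ → ℝ, e =O[atTop] ζ ∧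
    ∀ n, 1 ≤ n → ∀ P ∈ M.nullSet, ∀ θ ∈ M.nbhd P n ε,
      ENNReal.ofReal (ν n)⁻¹ * dirHausdorff (M.toE ι n {θ}) (M.toE ι n (M.popArgmin P n))
        ≤ ENNReal.ofReal (M.popCrit P n θ + e n)

end SieveModel

end

/-!
The proof compares the rescaled sample criterion `n^{-1/2} Q_n(θ)` with the population criterion
`m_{n,P}(θ)`, uniformly over the sieve. With `Σ̂_n` close to a matrix `Σ_n(P)` that is bounded
together with its inverse, each of the two criteria is at most a constant times the other plus
`n^{-1/2} ‖G_n(θ)‖_r`, where `G_n(θ)` is the empirical process of the moment functions. Since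
`‖a‖_r ≤ k^{1/r} max_i |a_i|`, everything rests on a maximal inequality for the products `f q_i`
of residuals `f ∈ 𝓕_n` and instruments `q_i`: uniformly in `P`, and for outer probability,
`sup_{f, i} |G_n (f q_i)| = O_p((log k_n)^{1/2} J_n B_n)`
(`IsIIDSample.measure_exists_lt_abs_empProc_mul`).

The maximal inequality is proved by bracketing chaining, in terms of exceptional events rather than
of expectations of suprema, so that no measurability of suprema is needed. Each function is
approximated from below by the largest lower end among its first `q` brackets. A link of the chain
takes only as many values as there are tuples of brackets, and is truncated at the level up to
which Bernstein's inequality is Gaussian for that number of functions. What exceeds the truncation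
level is controlled by its mean, which is at most the squared `L²` size divided by the level. For a
fixed sample size a chain of length `n` is enough, as the remainder is then bounded outright.
The exceptional probabilities sum to at most `42 / K`, whatever the class
(`BracketChain.measure_exists_lt_abs_empProc`), and the entropy sum along dyadic sizes is at most
twice the bracketing integral (`sum_entropy_le_bracketIntegral`).

On the event where the criteria are comparable the rest is deterministic. A near minimizer of the
sample criterion has population criterion at most a constant times `ζ_n + τ_n` plus the sampling
rate (`Comparable.popCrit_le_of_mem_setEst`). That is negligible against the separation `S_n(ε)`,
hence the point is in the neighbourhood of the population minimizers
(`mem_nbhd_of_popCrit_le`), where local identification turns the bound on the criterion into a bound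
on the distance. If `τ_n` dominates the sampling rate and `ζ_n`, then every population minimizer
belongs to the set estimator (`Comparable.popArgmin_subset_setEst`), and the other half of the
Hausdorff distance vanishes.
-/

noncomputable section

/-! ### The empirical process of an i.i.d. sample -/

/-- Under `Q`, the random variables `V 0, V 1, …` are i.i.d. with distribution `P`. -/
structure IsIIDSample {α Ω : Type*} [MeasurableSpace α] [MeasurableSpace Ω] (Q : Measure Ω)
    (V : ℕ → Ω → α) (P : Measure α) : Prop where
  measurable : ∀ i, Measurable (V i)
  indep : iIndepFun V Q
  map_eq : ∀ i, Q.map (V i) = P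

/-- The empirical process `G_n h = n^{-1/2} ∑_{i < n} (h(V_i) - P h)`. -/
def empProc {α Ω : Type*} [MeasurableSpace α] (P : Measure α) (V : ℕ → Ω → α) (n : ℕ)
    (h : α → ℝ) (ω : Ω) : ℝ :=
  (Real.sqrt n)⁻¹ * ∑ i ∈ Finset.range n, (h (V i ω) - ∫ v, h v ∂P)

section EmpProc

variable {α Ω : Type*} [MeasurableSpace α] {P : Measure α} {V : ℕ → Ω → α} {n : ℕ}

theorem empProc_add {h h' : α → ℝ} (hh : Integrable h P) (hh' : Integrable h' P) (ω : Ω) :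
    empProc P V n (fun v => h v + h' v) ω = empProc P V n h ω + empProc P V n h' ω := by
  unfold empProc
  rw [integral_add hh hh', ← mul_add, ← Finset.sum_add_distrib]
  congr 1
  exact Finset.sum_congr rfl fun i _ => by ring

theorem empProc_neg (h : α → ℝ) (ω : Ω) :
    empProc P V n (fun v => -h v) ω = -empProc P V n h ω := by
  unfold empProc
  rw [integral_neg, ← mul_neg, ← Finset.sum_neg_distrib]
  congr 1
  exact Finset.sum_congr rfl fun i _ => by ring

/-- Centring costs `√n P h` in the empirical process. -/
theorem empProc_eq (h : α → ℝ) (ω : Ω) :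
    empProc P V n h ω
      = (Real.sqrt n)⁻¹ * ∑ i ∈ Finset.range n, h (V i ω) - Real.sqrt n * ∫ v, h v ∂P := by
  unfold empProc
  rw [Finset.sum_sub_distrib, mul_sub]
  congr 1
  rw [Finset.sum_const, Finset.card_range, nsmul_eq_mul, ← mul_assoc]
  congr 1
  rcases Nat.eq_zero_or_pos n with rfl | hn
  · simp
  · have : (0 : ℝ) < n := by exact_mod_cast hn
    have h2 := Real.mul_self_sqrt this.le
    have h3 : Real.sqrt n ≠ 0 := (Real.sqrt_pos.2 this).ne'
    field_simp
    nlinarith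

/-- A function squeezed between `0` and `D` has its empirical process controlled by that of `D`,
up to the centring. -/
theorem abs_empProc_le_of_le {h D : α → ℝ} (hh : Integrable h P) (hD : Integrable D P)
    (h0 : ∀ v, 0 ≤ h v) (hle : ∀ v, h v ≤ D v) (ω : Ω) :
    |empProc P V n h ω| ≤ |empProc P V n D ω| + 2 * (Real.sqrt n * ∫ v, D v ∂P) := by
  have e1 := empProc_eq (P := P) (V := V) (n := n) h ω
  have e2 := empProc_eq (P := P) (V := V) (n := n) D ω
  have i1 : ∫ v, h v ∂P ≤ ∫ v, D v ∂P := integral_mono hh hD hle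
  have i0 : 0 ≤ ∫ v, h v ∂P := integral_nonneg h0
  have s0 : 0 ≤ Real.sqrt n := Real.sqrt_nonneg _
  have s1 : 0 ≤ (Real.sqrt n)⁻¹ * ∑ i ∈ Finset.range n, h (V i ω) :=
    mul_nonneg (inv_nonneg.2 s0) (Finset.sum_nonneg fun i _ => h0 _)
  have s2 : (Real.sqrt n)⁻¹ * ∑ i ∈ Finset.range n, h (V i ω)
      ≤ (Real.sqrt n)⁻¹ * ∑ i ∈ Finset.range n, D (V i ω) :=
    mul_le_mul_of_nonneg_left (Finset.sum_le_sum fun i _ => hle _) (inv_nonneg.2 s0)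
  have m1 := mul_le_mul_of_nonneg_left i1 s0
  have m0 := mul_nonneg s0 i0
  have := le_abs_self (empProc P V n D ω)
  have := abs_nonneg (empProc P V n D ω)
  rw [abs_le]
  constructor <;> linarith

theorem abs_empProc_le_of_bound [IsProbabilityMeasure P] {h : α → ℝ} {b : ℝ}
    (hb : ∀ v, |h v| ≤ b) (ω : Ω) :
    |empProc P V n h ω| ≤ 2 * Real.sqrt n * b := by
  rw [empProc_eq]
  have s0 : 0 ≤ Real.sqrt n := Real.sqrt_nonneg _
  have a1 : |∫ v, h v ∂P| ≤ b := by
    have := norm_integral_le_of_norm_le_const (μ := P) (f := h) (C := b)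
      (Eventually.of_forall fun v => by simpa using hb v)
    simpa using this
  have a2 : |∑ i ∈ Finset.range n, h (V i ω)| ≤ n * b := by
    refine (Finset.abs_sum_le_sum_abs _ _).trans ?_
    refine (Finset.sum_le_sum fun i _ => hb (V i ω)).trans ?_
    simp
  have a3 : |(Real.sqrt n)⁻¹ * ∑ i ∈ Finset.range n, h (V i ω)| ≤ Real.sqrt n * b := by
    rw [abs_mul, abs_of_nonneg (inv_nonneg.2 s0)]
    refine (mul_le_mul_of_nonneg_left a2 (inv_nonneg.2 s0)).trans (le_of_eq ?_)
    rcases Nat.eq_zero_or_pos n with rfl | hn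
    · simp
    · have : (0 : ℝ) < n := by exact_mod_cast hn
      have h3 : Real.sqrt n ≠ 0 := (Real.sqrt_pos.2 this).ne'
      field_simp
      rw [Real.sq_sqrt this.le]
  have a4 : |Real.sqrt n * ∫ v, h v ∂P| ≤ Real.sqrt n * b := by
    rw [abs_mul, abs_of_nonneg s0]
    exact mul_le_mul_of_nonneg_left a1 s0
  have := abs_sub ((Real.sqrt n)⁻¹ * ∑ i ∈ Finset.range n, h (V i ω)) (Real.sqrt n * ∫ v, h v ∂P)
  linarith

variable [MeasurableSpace Ω] {Q : Measure Ω}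

theorem IsIIDSample.integral_comp (hV : IsIIDSample Q V P) {h : α → ℝ}
    (hm : AEStronglyMeasurable h P) (i : ℕ) : ∫ ω, h (V i ω) ∂Q = ∫ v, h v ∂P := by
  rw [← hV.map_eq i, integral_map (hV.measurable i).aemeasurable (by rw [hV.map_eq i]; exact hm)]

theorem IsIIDSample.integrable_comp (hV : IsIIDSample Q V P) {h : α → ℝ}
    (hh : Integrable h P) (i : ℕ) : Integrable (fun ω => h (V i ω)) Q := by
  rw [← hV.map_eq i] at hh
  exact hh.comp_measurable (hV.measurable i)

/-- A centred variable bounded by `1/s` in absolute value has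
`E exp (s X) ≤ exp (s² E X²)`. -/
theorem mgf_le_exp_of_bounded [IsProbabilityMeasure Q] {X : Ω → ℝ} (hX : AEMeasurable X Q)
    {c s w : ℝ} (hs : 0 ≤ s) (hc : ∀ ω, |X ω| ≤ c) (hsc : s * c ≤ 1) (h0 : ∫ ω, X ω ∂Q = 0)
    (h2 : ∫ ω, X ω ^ 2 ∂Q ≤ w) :
    mgf X Q s ≤ Real.exp (s ^ 2 * w) := by
  have iX : Integrable X Q :=
    Integrable.of_bound hX.aestronglyMeasurable c (Eventually.of_forall hc)
  have iX2 : Integrable (fun ω => X ω ^ 2) Q := by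
    refine Integrable.of_bound (hX.pow_const 2).aestronglyMeasurable (c ^ 2)
      (Eventually.of_forall fun ω => ?_)
    rw [Real.norm_eq_abs, abs_pow]
    exact pow_le_pow_left₀ (abs_nonneg _) (hc ω) 2
  have hb : ∀ ω, |s * X ω| ≤ 1 := fun ω => by
    rw [abs_mul, abs_of_nonneg hs]
    exact (mul_le_mul_of_nonneg_left (hc ω) hs).trans hsc
  have hexp : ∀ ω, Real.exp (s * X ω) ≤ 1 + s * X ω + s ^ 2 * X ω ^ 2 := fun ω => by
    have := (abs_le.1 (Real.abs_exp_sub_one_sub_id_le (hb ω))).2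
    nlinarith
  have iE : Integrable (fun ω => Real.exp (s * X ω)) Q := by
    refine Integrable.of_bound
      (Real.measurable_exp.comp_aemeasurable (hX.const_mul s)).aestronglyMeasurable (Real.exp 1)
      (Eventually.of_forall fun ω => ?_)
    rw [Real.norm_eq_abs, abs_of_pos (Real.exp_pos _)]
    exact Real.exp_le_exp.2 ((le_abs_self _).trans (hb ω))
  have : mgf X Q s ≤ ∫ ω, (1 + s * X ω + s ^ 2 * X ω ^ 2) ∂Q :=
    integral_mono iE (((integrable_const 1).add (iX.const_mul s)).add (iX2.const_mul _)) hexp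
  refine this.trans ?_
  have i1 : Integrable (fun ω => 1 + s * X ω) Q := (integrable_const 1).add (iX.const_mul s)
  rw [integral_add i1 (iX2.const_mul _), integral_add (integrable_const 1) (iX.const_mul s),
    integral_const_mul, integral_const_mul, h0]
  simp only [integral_const, probReal_univ, smul_eq_mul, mul_one, mul_zero, add_zero]
  have h3 := mul_le_mul_of_nonneg_left h2 (sq_nonneg s)
  have := Real.add_one_le_exp (s ^ 2 * w)
  linarith

/-- Bernstein's inequality in the range where the variance term dominates. -/
theorem IsIIDSample.measure_le_empProc [IsProbabilityMeasure Q] [IsProbabilityMeasure P]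
    (hV : IsIIDSample Q V P) (hn : 1 ≤ n) {h : α → ℝ} (hm : AEMeasurable h P) {b σ lam : ℝ}
    (hb : ∀ v, |h v| ≤ b) (hσ : ∫ v, h v ^ 2 ∂P ≤ σ ^ 2) (hlam : 0 ≤ lam)
    (hlb : 2 * lam * b ≤ Real.sqrt n) (t : ℝ) :
    Q {ω | t ≤ empProc P V n h ω} ≤ ENNReal.ofReal (Real.exp (-lam * t + lam ^ 2 * σ ^ 2)) := by
  have hnpos : (0 : ℝ) < n := by exact_mod_cast hn
  have hs0 : 0 < Real.sqrt n := Real.sqrt_pos.2 hnpos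
  set s := lam / Real.sqrt n with hs
  have hs_nonneg : 0 ≤ s := div_nonneg hlam hs0.le
  set μ := ∫ v, h v ∂P with hμ
  have hmean : |μ| ≤ b := by
    have := norm_integral_le_of_norm_le_const (μ := P) (f := h) (C := b)
      (Eventually.of_forall fun v => by simpa using hb v)
    simpa using this
  set X : ℕ → Ω → ℝ := fun i ω => h (V i ω) - μ with hX
  have ih : Integrable h P :=
    Integrable.of_bound hm.aestronglyMeasurable b (Eventually.of_forall hb)
  have ih2 : Integrable (fun v => h v ^ 2) P := by
    refine Integrable.of_bound (hm.pow_const 2).aestronglyMeasurable (b ^ 2)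
      (Eventually.of_forall fun ω => ?_)
    rw [Real.norm_eq_abs, abs_pow]
    exact pow_le_pow_left₀ (abs_nonneg _) (hb ω) 2
  have hXm : ∀ i, AEMeasurable (X i) Q := fun i =>
    (AEMeasurable.comp_measurable (by rw [hV.map_eq i]; exact hm) (hV.measurable i)).sub_const μ
  have hXind : iIndepFun X Q := by
    have := hV.indep.comp₀ (fun _ v => h v - μ) (fun i => (hV.measurable i).aemeasurable)
      (fun i => by rw [hV.map_eq i]; exact hm.sub_const μ)
    exact this
  have hXb : ∀ i ω, |X i ω| ≤ 2 * b := fun i ω => by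
    have := abs_sub (h (V i ω)) μ
    have := hb (V i ω)
    simp only [hX]
    linarith
  have hX0 : ∀ i, ∫ ω, X i ω ∂Q = 0 := fun i => by
    have := hV.integral_comp (h := fun v => h v - μ)
      (hm.sub_const μ).aestronglyMeasurable i
    simp only [hX]
    rw [this, integral_sub ih (integrable_const _)]
    simp [hμ]
  have hX2 : ∀ i, ∫ ω, X i ω ^ 2 ∂Q ≤ σ ^ 2 := fun i => by
    have := hV.integral_comp (h := fun v => (h v - μ) ^ 2)
      ((hm.sub_const μ).pow_const 2).aestronglyMeasurable i
    simp only [hX]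
    rw [this]
    have : ∫ v, (h v - μ) ^ 2 ∂P = ∫ v, h v ^ 2 ∂P - μ ^ 2 := by
      have e : ∀ v, (h v - μ) ^ 2 = h v ^ 2 - 2 * μ * h v + μ ^ 2 := fun v => by ring
      simp_rw [e]
      have i1 : Integrable (fun v => h v ^ 2 - 2 * μ * h v) P := ih2.sub (ih.const_mul _)
      rw [integral_add i1 (integrable_const _),
        integral_sub ih2 (ih.const_mul _), integral_const_mul]
      simp only [integral_const, probReal_univ, smul_eq_mul, ← hμ]
      ring
    nlinarith [sq_nonneg μ]
  have hmgf : mgf (∑ i ∈ Finset.range n, X i) Q s ≤ Real.exp (lam ^ 2 * σ ^ 2) := by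
    rw [hXind.mgf_sum₀ hXm]
    have : ∏ i ∈ Finset.range n, mgf (X i) Q s
        ≤ ∏ _i ∈ Finset.range n, Real.exp (s ^ 2 * σ ^ 2) := by
      refine Finset.prod_le_prod (fun i _ => mgf_nonneg) fun i _ => ?_
      refine mgf_le_exp_of_bounded (hXm i) hs_nonneg (hXb i) ?_ (hX0 i) (hX2 i)
      rw [hs, div_mul_eq_mul_div, div_le_one hs0]
      linarith
    refine this.trans (le_of_eq ?_)
    rw [Finset.prod_const, Finset.card_range, ← Real.exp_nat_mul]
    congr 1
    rw [hs, div_pow, Real.sq_sqrt hnpos.le]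
    field_simp
  have hint : Integrable (fun ω => Real.exp (s * (∑ i ∈ Finset.range n, X i) ω)) Q := by
    refine Integrable.of_bound
      (Real.measurable_exp.comp_aemeasurable
        ((Finset.aemeasurable_sum _ fun i _ => hXm i).const_mul s)).aestronglyMeasurable
      (Real.exp (s * (n * (2 * b)))) (Eventually.of_forall fun ω => ?_)
    rw [Real.norm_eq_abs, abs_of_pos (Real.exp_pos _)]
    refine Real.exp_le_exp.2 (mul_le_mul_of_nonneg_left ?_ hs_nonneg)
    rw [Finset.sum_apply]
    refine (Finset.sum_le_sum fun i _ => (le_abs_self _).trans (hXb i ω)).trans ?_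
    simp
  have hch := measure_ge_le_exp_mul_mgf (μ := Q) (X := ∑ i ∈ Finset.range n, X i)
    (Real.sqrt n * t) hs_nonneg hint
  have hset : {ω | t ≤ empProc P V n h ω}
      = {ω | Real.sqrt n * t ≤ (∑ i ∈ Finset.range n, X i) ω} := by
    ext ω
    simp only [Set.mem_ofPred_eq, empProc, Finset.sum_apply]
    rw [← div_eq_inv_mul, le_div_iff₀ hs0, mul_comm]
  rw [hset, ← ofReal_measureReal]
  refine ENNReal.ofReal_le_ofReal (hch.trans ?_)
  rw [Real.exp_add]
  refine mul_le_mul (le_of_eq ?_) hmgf mgf_nonneg (Real.exp_pos _).le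
  congr 1
  rw [hs]
  field_simp

theorem IsIIDSample.measure_le_abs_empProc [IsProbabilityMeasure Q] [IsProbabilityMeasure P]
    (hV : IsIIDSample Q V P) (hn : 1 ≤ n) {h : α → ℝ} (hm : AEMeasurable h P) {b σ lam : ℝ}
    (hb : ∀ v, |h v| ≤ b) (hσ : ∫ v, h v ^ 2 ∂P ≤ σ ^ 2) (hlam : 0 ≤ lam)
    (hlb : 2 * lam * b ≤ Real.sqrt n) (t : ℝ) :
    Q {ω | t ≤ |empProc P V n h ω|}
      ≤ ENNReal.ofReal (2 * Real.exp (-lam * t + lam ^ 2 * σ ^ 2)) := by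
  have h1 := hV.measure_le_empProc hn hm hb hσ hlam hlb t
  have h2 := hV.measure_le_empProc hn (h := fun v => -h v) hm.neg
    (fun v => by rw [abs_neg]; exact hb v) (by simpa using hσ) hlam hlb t
  have hsub : {ω | t ≤ |empProc P V n h ω|} ⊆
      {ω | t ≤ empProc P V n h ω} ∪ {ω | t ≤ empProc P V n (fun v => -h v) ω} := by
    intro ω hω
    simp only [Set.mem_union, Set.mem_ofPred_eq, empProc_neg] at hω ⊢
    exact le_abs.1 hω
  refine (measure_mono hsub).trans ((measure_union_le _ _).trans ?_)
  refine (add_le_add h1 h2).trans (le_of_eq ?_)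
  rw [← ENNReal.ofReal_add (Real.exp_pos _).le (Real.exp_pos _).le, two_mul]

end EmpProc

/-! ### A union bound -/

section Maximal

variable {α Ω : Type*} [MeasurableSpace α] {P : Measure α} {V : ℕ → Ω → α} {n : ℕ}

theorem abs_empProc_le_of_abs_le {h D : α → ℝ} (hD : Integrable D P)
    (hle : ∀ v, |h v| ≤ D v) (ω : Ω) :
    |empProc P V n h ω| ≤ (Real.sqrt n)⁻¹ * ∑ i ∈ Finset.range n, D (V i ω)
      + Real.sqrt n * ∫ v, D v ∂P := by
  rw [empProc_eq]
  have s0 : 0 ≤ Real.sqrt n := Real.sqrt_nonneg _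
  refine (abs_sub _ _).trans (add_le_add ?_ ?_)
  · rw [abs_mul, abs_of_nonneg (inv_nonneg.2 s0)]
    exact mul_le_mul_of_nonneg_left
      ((Finset.abs_sum_le_sum_abs _ _).trans (Finset.sum_le_sum fun i _ => hle _))
      (inv_nonneg.2 s0)
  · rw [abs_mul, abs_of_nonneg s0]
    refine mul_le_mul_of_nonneg_left ?_ s0
    exact norm_integral_le_of_norm_le (f := h) hD (Eventually.of_forall hle)

variable [MeasurableSpace Ω] {Q : Measure Ω}

/-- Union bound for a family that takes at most `card κ` different values. -/
theorem IsIIDSample.measure_exists_le_abs_empProc [IsProbabilityMeasure Q]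
    [IsProbabilityMeasure P] (hV : IsIIDSample Q V P) (hn : 1 ≤ n) {T κ : Type*} [Fintype κ]
    (f : T → κ) (h : T → α → ℝ) (hf : ∀ t t', f t = f t' → h t = h t')
    (hm : ∀ t, AEMeasurable (h t) P) {b σ lam : ℝ}
    (hb : ∀ t v, |h t v| ≤ b) (hσ : ∀ t, ∫ v, h t v ^ 2 ∂P ≤ σ ^ 2) (hlam : 0 ≤ lam)
    (hlb : 2 * lam * b ≤ Real.sqrt n) (x : ℝ) :
    Q {ω | ∃ t, x ≤ |empProc P V n (h t) ω|}
      ≤ ENNReal.ofReal (Fintype.card κ * (2 * Real.exp (-lam * x + lam ^ 2 * σ ^ 2))) := by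
  have hsub : {ω | ∃ t, x ≤ |empProc P V n (h t) ω|}
      ⊆ ⋃ k : κ, {ω | ∃ t, f t = k ∧ x ≤ |empProc P V n (h t) ω|} := by
    intro ω hω
    simp only [Set.mem_iUnion, Set.mem_ofPred_eq] at hω ⊢
    obtain ⟨t, ht⟩ := hω
    exact ⟨f t, t, rfl, ht⟩
  refine (measure_mono hsub).trans ((measure_iUnion_fintype_le _ _).trans ?_)
  have hk : ∀ k : κ, Q {ω | ∃ t, f t = k ∧ x ≤ |empProc P V n (h t) ω|}
      ≤ ENNReal.ofReal (2 * Real.exp (-lam * x + lam ^ 2 * σ ^ 2)) := by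
    intro k
    by_cases hex : ∃ t, f t = k
    · obtain ⟨t₀, ht₀⟩ := hex
      refine (measure_mono ?_).trans
        (hV.measure_le_abs_empProc hn (hm t₀) (hb t₀) (hσ t₀) hlam hlb x)
      intro ω hω
      simp only [Set.mem_ofPred_eq] at hω ⊢
      obtain ⟨t, ht, hx⟩ := hω
      rwa [hf t₀ t (ht₀.trans ht.symm)]
    · have : {ω | ∃ t, f t = k ∧ x ≤ |empProc P V n (h t) ω|} = ∅ := by
        ext ω
        simp only [Set.mem_ofPred_eq, Set.mem_empty_iff_false, iff_false]
        rintro ⟨t, ht, -⟩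
        exact hex ⟨t, ht⟩
      rw [this, measure_empty]
      exact zero_le
  refine (Finset.sum_le_sum fun k _ => hk k).trans (le_of_eq ?_)
  rw [Finset.sum_const, nsmul_eq_mul, ENNReal.ofReal_mul (Nat.cast_nonneg _),
    ENNReal.ofReal_natCast, Finset.card_univ]

end Maximal

/-! ### Chaining with brackets -/

/-- A class of functions `g t` with square integrable envelope `H`, `‖H‖_{L²} ≤ δ`, and for each
`p` a finite family of brackets of `L²` size `2^{-p} δ`; `code p t` is the bracket of `g t` in the
`p`-th family, whose cardinality is at most `exp (s_p² - 1)`. -/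
structure BracketChain {α : Type*} [MeasurableSpace α] (P : Measure α) (T : Type*) where
  /-- The functions of the class. -/
  g : T → α → ℝ
  /-- The envelope. -/
  H : α → ℝ
  /-- The size of the envelope. -/
  δ : ℝ
  δ_pos : 0 < δ
  measurable_g : ∀ t, AEMeasurable (g t) P
  memLp_H : MemLp H 2 P
  integral_H_sq : ∫ v, H v ^ 2 ∂P ≤ δ ^ 2
  abs_g_le : ∀ t v, |g t v| ≤ H v
  /-- The index type of the `p`-th family of brackets. -/
  κ : ℕ → Type
  fintype_κ : ∀ p, Fintype (κ p)
  /-- The bracket that is chosen for `g t`. -/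
  code : ∀ p, T → κ p
  /-- The lower ends. -/
  lo : ∀ p, κ p → α → ℝ
  /-- The upper ends. -/
  up : ∀ p, κ p → α → ℝ
  memLp_lo : ∀ p i, MemLp (lo p i) 2 P
  memLp_up : ∀ p i, MemLp (up p i) 2 P
  lo_le : ∀ p t v, lo p (code p t) v ≤ g t v
  le_up : ∀ p t v, g t v ≤ up p (code p t) v
  width : ∀ p i, ∫ v, (up p i v - lo p i v) ^ 2 ∂P ≤ ((1 / 2) ^ p * δ) ^ 2
  /-- The entropy numbers. -/
  s : ℕ → ℝ
  one_le_s : ∀ p, 1 ≤ s p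
  card_le : ∀ p, (Fintype.card (κ p) : ℝ) ≤ Real.exp (s p ^ 2 - 1)

attribute [instance] BracketChain.fintype_κ

namespace BracketChain

variable {α T : Type*} [MeasurableSpace α] {P : Measure α} (C : BracketChain P T)

/-- The largest of the lower ends of the first `q` brackets of `g t`, and of `-H`. -/
def lower : ℕ → T → α → ℝ
  | 0, _ => fun v => -C.H v
  | q + 1, t => fun v => max (lower q t v) (C.lo q (C.code q t) v)

/-- The smallest of the upper ends of the first `q` brackets of `g t`, and of `H`. -/
def upper : ℕ → T → α → ℝ
  | 0, _ => fun v => C.H v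
  | q + 1, t => fun v => min (upper q t v) (C.up q (C.code q t) v)

/-- The width of the intersection of the first `q` brackets. -/
def gap (q : ℕ) (t : T) : α → ℝ := fun v => C.upper q t v - C.lower q t v

/-- The bound for `‖gap q t‖_{L²}`. -/
def mesh (q : ℕ) : ℝ := 2 * (1 / 2) ^ q * C.δ

/-- Accumulated entropy of the first `q` families. -/
def entropy (q : ℕ) : ℝ := ∑ p ∈ Finset.range q, C.s p

/-- The level at which `gap q t` is truncated: the largest one at which Bernstein's inequality
is still in its Gaussian range for `entropy (q + 1)`. -/
def trunc (n q : ℕ) : ℝ := Real.sqrt n * C.mesh q / (2 * C.entropy (q + 1))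

/-- The points at which none of the first `q + 1` gaps exceeds its truncation level. -/
def tame (n : ℕ) : ℕ → T → Set α
  | 0, t => {v | C.gap 0 t v ≤ C.trunc n 0}
  | q + 1, t => tame n q t ∩ {v | C.gap (q + 1) t v ≤ C.trunc n (q + 1)}

theorem lower_le (q : ℕ) (t : T) (v : α) : C.lower q t v ≤ C.g t v := by
  induction q with
  | zero => exact neg_le_of_abs_le (C.abs_g_le t v)
  | succ q ih => exact max_le ih (C.lo_le q t v)

theorem le_upper (q : ℕ) (t : T) (v : α) : C.g t v ≤ C.upper q t v := by
  induction q with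
  | zero => exact le_of_abs_le (C.abs_g_le t v)
  | succ q ih => exact le_min ih (C.le_up q t v)

theorem lower_mono (q : ℕ) (t : T) (v : α) : C.lower q t v ≤ C.lower (q + 1) t v :=
  le_max_left _ _

theorem upper_anti (q : ℕ) (t : T) (v : α) : C.upper (q + 1) t v ≤ C.upper q t v :=
  min_le_left _ _

theorem gap_nonneg (q : ℕ) (t : T) (v : α) : 0 ≤ C.gap q t v :=
  sub_nonneg.2 ((C.lower_le q t v).trans (C.le_upper q t v))

theorem gap_anti (q : ℕ) (t : T) (v : α) : C.gap (q + 1) t v ≤ C.gap q t v :=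
  sub_le_sub (C.upper_anti q t v) (C.lower_mono q t v)

theorem gap_le (q : ℕ) (t : T) (v : α) : C.gap q t v ≤ 2 * C.H v := by
  induction q with
  | zero => simp only [gap, upper, lower]; linarith
  | succ q ih => exact (C.gap_anti q t v).trans ih

theorem H_nonneg (t : T) (v : α) : 0 ≤ C.H v := (abs_nonneg _).trans (C.abs_g_le t v)

theorem aemeasurable_H : AEMeasurable C.H P := C.memLp_H.aestronglyMeasurable.aemeasurable

theorem aemeasurable_lower (q : ℕ) (t : T) : AEMeasurable (C.lower q t) P := by
  induction q with
  | zero => exact C.aemeasurable_H.neg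
  | succ q ih => exact ih.max (C.memLp_lo _ _).aestronglyMeasurable.aemeasurable

theorem aemeasurable_upper (q : ℕ) (t : T) : AEMeasurable (C.upper q t) P := by
  induction q with
  | zero => exact C.aemeasurable_H
  | succ q ih => exact ih.min (C.memLp_up _ _).aestronglyMeasurable.aemeasurable

theorem aemeasurable_gap (q : ℕ) (t : T) : AEMeasurable (C.gap q t) P :=
  (C.aemeasurable_upper q t).sub (C.aemeasurable_lower q t)

theorem nullMeasurableSet_tame (n q : ℕ) (t : T) : NullMeasurableSet (C.tame n q t) P := by
  induction q with
  | zero => exact nullMeasurableSet_le (C.aemeasurable_gap 0 t) aemeasurable_const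
  | succ q ih =>
    exact ih.inter (nullMeasurableSet_le (C.aemeasurable_gap (q + 1) t) aemeasurable_const)

theorem gap_le_of_mem_tame {n q : ℕ} {t : T} {v : α} (hv : v ∈ C.tame n q t) :
    C.gap q t v ≤ C.trunc n q := by
  cases q with
  | zero => exact hv
  | succ q => exact hv.2

theorem memLp_gap (q : ℕ) (t : T) : MemLp (C.gap q t) 2 P := by
  refine MemLp.of_le (C.memLp_H.const_mul 2) (C.aemeasurable_gap q t).aestronglyMeasurable
    (Eventually.of_forall fun v => ?_)
  rw [Real.norm_eq_abs, Real.norm_eq_abs, abs_of_nonneg (C.gap_nonneg q t v)]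
  exact (C.gap_le q t v).trans (le_abs_self _)

theorem integral_gap_sq (q : ℕ) (t : T) : ∫ v, C.gap q t v ^ 2 ∂P ≤ C.mesh q ^ 2 := by
  cases q with
  | zero =>
    have : ∀ v, C.gap 0 t v ^ 2 = 4 * C.H v ^ 2 := fun v => by
      simp only [gap, upper, lower]; ring
    simp_rw [this]
    rw [integral_const_mul]
    have := C.integral_H_sq
    simp only [mesh, pow_zero]
    nlinarith
  | succ q =>
    have e : C.mesh (q + 1) = (1 / 2) ^ q * C.δ := by simp only [mesh, pow_succ]; ring
    rw [e]
    refine le_trans ?_ (C.width q (C.code q t))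
    refine integral_mono (C.memLp_gap _ t).integrable_sq
      ((C.memLp_up q _).sub (C.memLp_lo q _)).integrable_sq fun v => ?_
    refine pow_le_pow_left₀ (C.gap_nonneg _ t v) ?_ 2
    exact sub_le_sub (min_le_right _ _) (le_max_right _ _)

/-- Only the first `q` brackets of `g t` enter its lower end at level `q`. -/
theorem lower_congr {q : ℕ} {t t' : T} (h : ∀ p < q, C.code p t = C.code p t') :
    C.lower q t = C.lower q t' := by
  induction q with
  | zero => rfl
  | succ q ih =>
    funext v
    simp only [lower]
    rw [ih fun p hp => h p (hp.trans q.lt_succ_self), h q q.lt_succ_self]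

theorem upper_congr {q : ℕ} {t t' : T} (h : ∀ p < q, C.code p t = C.code p t') :
    C.upper q t = C.upper q t' := by
  induction q with
  | zero => rfl
  | succ q ih =>
    funext v
    simp only [upper]
    rw [ih fun p hp => h p (hp.trans q.lt_succ_self), h q q.lt_succ_self]

theorem gap_congr {q : ℕ} {t t' : T} (h : ∀ p < q, C.code p t = C.code p t') :
    C.gap q t = C.gap q t' := by
  unfold gap
  rw [C.lower_congr h, C.upper_congr h]

theorem tame_congr {n q : ℕ} {t t' : T} (h : ∀ p < q, C.code p t = C.code p t') :
    C.tame n q t = C.tame n q t' := by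
  induction q with
  | zero => rfl
  | succ q ih =>
    simp only [tame]
    rw [ih fun p hp => h p (hp.trans q.lt_succ_self), C.gap_congr h]

theorem mesh_pos (q : ℕ) : 0 < C.mesh q := by
  have := C.δ_pos
  unfold mesh
  positivity

theorem entropy_nonneg (q : ℕ) : 0 ≤ C.entropy q :=
  Finset.sum_nonneg fun p _ => zero_le_one.trans (C.one_le_s p)

theorem one_le_entropy (q : ℕ) : 1 ≤ C.entropy (q + 1) := by
  have h := C.entropy_nonneg q
  have := C.one_le_s q
  unfold entropy at h ⊢
  rw [Finset.sum_range_succ]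
  linarith

theorem sum_sq_le_entropy_sq (q : ℕ) :
    ∑ p ∈ Finset.range q, C.s p ^ 2 ≤ C.entropy q ^ 2 :=
  Finset.sum_sq_le_sq_sum_of_nonneg fun p _ => zero_le_one.trans (C.one_le_s p)

/-- The number of tuples of brackets at level `q`; the term `-q` comes from `s_p² - 1` in the
cardinality bound and makes the exceptional probabilities summable over the levels. -/
theorem card_code_le (q : ℕ) :
    (Fintype.card (∀ p : Fin q, C.κ p) : ℝ) ≤ Real.exp (C.entropy q ^ 2 - q) := by
  rw [Fintype.card_pi]
  push_cast
  calc ∏ p : Fin q, (Fintype.card (C.κ p) : ℝ)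
      ≤ ∏ p : Fin q, Real.exp (C.s p ^ 2 - 1) :=
        Finset.prod_le_prod (fun _ _ => Nat.cast_nonneg _) fun p _ => C.card_le p
    _ = Real.exp (∑ p ∈ Finset.range q, (C.s p ^ 2 - 1)) := by
        rw [Real.exp_sum, Finset.prod_range]
    _ ≤ Real.exp (C.entropy q ^ 2 - q) := by
        refine Real.exp_le_exp.2 ?_
        have := C.sum_sq_le_entropy_sq q
        rw [Finset.sum_sub_distrib]
        simp only [Finset.sum_const, Finset.card_range, nsmul_eq_mul, mul_one]
        linarith

/-- Exchanging the order of summation, `∑_q 2^{-q} ∑_{p ≤ q} s_p ≤ 2 ∑_p 2^{-p} s_p`. -/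
theorem sum_mesh_mul_entropy_le (N : ℕ) :
    ∑ q ∈ Finset.range N, C.mesh q * C.entropy (q + 1)
      ≤ 4 * C.δ * ∑ p ∈ Finset.range N, (1 / 2) ^ p * C.s p := by
  have key : ∀ N : ℕ, ∑ q ∈ Finset.range N, C.mesh q * C.entropy (q + 1)
      + 2 * C.mesh N * C.entropy N = 4 * C.δ * ∑ p ∈ Finset.range N, (1 / 2) ^ p * C.s p := by
    intro N
    induction N with
    | zero => simp [entropy]
    | succ N ih =>
      rw [Finset.sum_range_succ, Finset.sum_range_succ _ N, mul_add, ← ih]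
      have e1 : C.mesh (N + 1) = C.mesh N / 2 := by simp only [mesh, pow_succ]; ring
      have e2 : C.entropy (N + 1) = C.entropy N + C.s N := by
        simp only [entropy]; rw [Finset.sum_range_succ]
      rw [e1, e2]
      simp only [mesh]
      ring
  have := key N
  have := mul_nonneg (C.mesh_pos N).le (C.entropy_nonneg N)
  linarith

theorem trunc_nonneg (n q : ℕ) : 0 ≤ C.trunc n q :=
  div_nonneg (mul_nonneg (Real.sqrt_nonneg _) (C.mesh_pos q).le)
    (mul_nonneg zero_le_two (C.entropy_nonneg _))

theorem trunc_pos {n : ℕ} (hn : 1 ≤ n) (q : ℕ) : 0 < C.trunc n q := by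
  have h1 : (0 : ℝ) < Real.sqrt n := Real.sqrt_pos.2 (by exact_mod_cast hn)
  have h2 := C.mesh_pos q
  have h3 := C.one_le_entropy q
  unfold trunc
  positivity

/-- The increment of the lower ends from level `q` to `q + 1`, on the tame points. -/
def link (n q : ℕ) (t : T) : α → ℝ :=
  (C.tame n q t).indicator fun v => C.lower (q + 1) t v - C.lower q t v

/-- The gap at level `q + 1` at the points where it is the first to exceed its truncation level. -/
def drop (n q : ℕ) (t : T) : α → ℝ :=
  (C.tame n q t \ C.tame n (q + 1) t).indicator (C.gap (q + 1) t)

/-- What is left of `g t` above the lower end of level `q`, on the tame points. -/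
def rest (n q : ℕ) (t : T) : α → ℝ :=
  (C.tame n q t).indicator fun v => C.g t v - C.lower q t v

/-- What is left of `g t` above the lower end of level `q + 1`, at the points that stop being tame
there. -/
def restDrop (n q : ℕ) (t : T) : α → ℝ :=
  (C.tame n q t \ C.tame n (q + 1) t).indicator fun v => C.g t v - C.lower (q + 1) t v

theorem tame_succ_subset (n q : ℕ) (t : T) : C.tame n (q + 1) t ⊆ C.tame n q t :=
  Set.inter_subset_left

/-- The remainder splits into a link, the points that stop being tame, and the next remainder. -/
theorem rest_eq (n q : ℕ) (t : T) (v : α) :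
    C.rest n q t v = C.link n q t v + (C.restDrop n q t v + C.rest n (q + 1) t v) := by
  unfold rest link restDrop
  by_cases h1 : v ∈ C.tame n q t
  · by_cases h2 : v ∈ C.tame n (q + 1) t
    · simp [h1, h2]
    · simp [h1, h2]
  · have h2 : v ∉ C.tame n (q + 1) t := fun h => h1 (C.tame_succ_subset n q t h)
    simp [h1, h2]

theorem abs_link_le (n q : ℕ) (t : T) (v : α) :
    |C.link n q t v| ≤ (C.tame n q t).indicator (C.gap q t) v := by
  unfold link
  by_cases hv : v ∈ C.tame n q t
  · rw [Set.indicator_of_mem hv, Set.indicator_of_mem hv,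
      abs_of_nonneg (sub_nonneg.2 (C.lower_mono q t v))]
    exact sub_le_sub_right ((C.lower_le _ t v).trans (C.le_upper _ t v)) _
  · rw [Set.indicator_of_notMem hv, Set.indicator_of_notMem hv, abs_zero]

theorem drop_nonneg (n q : ℕ) (t : T) (v : α) : 0 ≤ C.drop n q t v :=
  Set.indicator_nonneg (fun v _ => C.gap_nonneg _ t v) v

theorem abs_drop_le (n q : ℕ) (t : T) (v : α) :
    |C.drop n q t v| ≤ (C.tame n q t).indicator (C.gap q t) v := by
  rw [abs_of_nonneg (C.drop_nonneg n q t v)]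
  unfold drop
  refine (Set.indicator_le_indicator_of_subset Set.sdiff_subset
    (fun v => C.gap_nonneg _ t v) v).trans ?_
  exact Set.indicator_le_indicator (C.gap_anti q t v)

theorem aemeasurable_link (n q : ℕ) (t : T) : AEMeasurable (C.link n q t) P :=
  ((C.aemeasurable_lower (q + 1) t).sub (C.aemeasurable_lower q t)).indicator₀
    (C.nullMeasurableSet_tame n q t)

theorem aemeasurable_drop (n q : ℕ) (t : T) : AEMeasurable (C.drop n q t) P :=
  (C.aemeasurable_gap (q + 1) t).indicator₀
    ((C.nullMeasurableSet_tame n q t).diff (C.nullMeasurableSet_tame n (q + 1) t))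

theorem aemeasurable_rest (n q : ℕ) (t : T) : AEMeasurable (C.rest n q t) P :=
  ((C.measurable_g t).sub (C.aemeasurable_lower q t)).indicator₀ (C.nullMeasurableSet_tame n q t)

theorem aemeasurable_restDrop (n q : ℕ) (t : T) : AEMeasurable (C.restDrop n q t) P :=
  ((C.measurable_g t).sub (C.aemeasurable_lower (q + 1) t)).indicator₀
    ((C.nullMeasurableSet_tame n q t).diff (C.nullMeasurableSet_tame n (q + 1) t))

theorem link_congr {n q : ℕ} {t t' : T} (h : ∀ p < q + 1, C.code p t = C.code p t') :
    C.link n q t = C.link n q t' := by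
  have h' : ∀ p < q, C.code p t = C.code p t' := fun p hp => h p (hp.trans q.lt_succ_self)
  unfold link
  rw [C.lower_congr h, C.lower_congr h', C.tame_congr h']

theorem drop_congr {n q : ℕ} {t t' : T} (h : ∀ p < q + 1, C.code p t = C.code p t') :
    C.drop n q t = C.drop n q t' := by
  have h' : ∀ p < q, C.code p t = C.code p t' := fun p hp => h p (hp.trans q.lt_succ_self)
  unfold drop
  rw [C.gap_congr h, C.tame_congr h, C.tame_congr h']

theorem integrable_H [IsFiniteMeasure P] : Integrable C.H P :=
  C.memLp_H.integrable one_le_two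

theorem integrable_of_abs_le [IsFiniteMeasure P] {f : α → ℝ} (hm : AEMeasurable f P)
    (hle : ∀ v, |f v| ≤ 2 * C.H v) : Integrable f P :=
  Integrable.mono' (C.integrable_H.const_mul 2) hm.aestronglyMeasurable
    (Eventually.of_forall hle)

theorem abs_indicator_le_two_mul (S : Set α) (t : T) {f : α → ℝ} (hf : ∀ v, 0 ≤ f v)
    (hle : ∀ v, f v ≤ 2 * C.H v) (v : α) : |S.indicator f v| ≤ 2 * C.H v := by
  rw [abs_of_nonneg (Set.indicator_nonneg (fun v _ => hf v) v)]
  exact Set.indicator_le' (fun v _ => hle v) (fun v _ => by linarith [C.H_nonneg t v]) v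

theorem sub_lower_le (q : ℕ) (t : T) (v : α) : C.g t v - C.lower q t v ≤ C.gap q t v :=
  sub_le_sub_right (C.le_upper q t v) _

theorem integrable_link [IsFiniteMeasure P] (n q : ℕ) (t : T) : Integrable (C.link n q t) P :=
  C.integrable_of_abs_le (C.aemeasurable_link n q t) fun v =>
    (C.abs_link_le n q t v).trans ((le_abs_self _).trans
      (C.abs_indicator_le_two_mul _ t (C.gap_nonneg q t) (C.gap_le q t) v))

theorem integrable_drop [IsFiniteMeasure P] (n q : ℕ) (t : T) : Integrable (C.drop n q t) P :=
  C.integrable_of_abs_le (C.aemeasurable_drop n q t)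
    (C.abs_indicator_le_two_mul _ t (C.gap_nonneg _ t) (C.gap_le _ t))

theorem integrable_rest [IsFiniteMeasure P] (n q : ℕ) (t : T) : Integrable (C.rest n q t) P :=
  C.integrable_of_abs_le (C.aemeasurable_rest n q t)
    (C.abs_indicator_le_two_mul _ t (fun v => sub_nonneg.2 (C.lower_le _ t v))
      fun v => (C.sub_lower_le q t v).trans (C.gap_le q t v))

theorem integrable_restDrop [IsFiniteMeasure P] (n q : ℕ) (t : T) :
    Integrable (C.restDrop n q t) P :=
  C.integrable_of_abs_le (C.aemeasurable_restDrop n q t)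
    (C.abs_indicator_le_two_mul _ t (fun v => sub_nonneg.2 (C.lower_le _ t v))
      fun v => (C.sub_lower_le _ t v).trans (C.gap_le _ t v))

/-- Cutting a square integrable function above the level `c` leaves a mean of at most `w / c`. -/
theorem integral_indicator_le {f : α → ℝ} (hf : MemLp f 2 P) (hf0 : ∀ v, 0 ≤ f v) {S : Set α}
    {c w : ℝ} (hc : 0 < c) (hS : ∀ v ∈ S, c < f v) (hw : ∫ v, f v ^ 2 ∂P ≤ w) :
    ∫ v, S.indicator f v ∂P ≤ w / c := by
  have : ∫ v, S.indicator f v ∂P ≤ ∫ v, c⁻¹ * f v ^ 2 ∂P := by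
    refine integral_mono_of_nonneg
      (Eventually.of_forall fun v => Set.indicator_nonneg (fun v _ => hf0 v) v)
      (hf.integrable_sq.const_mul _) (Eventually.of_forall fun v => ?_)
    refine Set.indicator_le' (f := f) (g := fun v => c⁻¹ * f v ^ 2) (fun v hv => ?_)
      (fun v _ => by positivity) v
    rw [← div_eq_inv_mul, le_div_iff₀ hc, sq]
    exact mul_le_mul_of_nonneg_left (hS v hv).le (hf0 v)
  refine this.trans ?_
  rw [integral_const_mul, ← div_eq_inv_mul]
  exact div_le_div_of_nonneg_right hw hc.le

theorem sqrt_mul_integral_drop_le {n : ℕ} (hn : 1 ≤ n) (q : ℕ) (t : T) :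
    Real.sqrt n * ∫ v, C.drop n q t v ∂P ≤ 2 * (C.mesh (q + 1) * C.entropy (q + 2)) := by
  have h1 : (0 : ℝ) < Real.sqrt n := Real.sqrt_pos.2 (by exact_mod_cast hn)
  have h2 := C.mesh_pos (q + 1)
  have h3 := C.one_le_entropy (q + 1)
  have := integral_indicator_le (C.memLp_gap (q + 1) t) (C.gap_nonneg (q + 1) t)
    (S := C.tame n q t \ C.tame n (q + 1) t) (C.trunc_pos hn (q + 1))
    (fun v hv => by
      by_contra hcon
      exact hv.2 ⟨hv.1, not_lt.1 hcon⟩) (C.integral_gap_sq (q + 1) t)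
  refine (mul_le_mul_of_nonneg_left this h1.le).trans (le_of_eq ?_)
  have h4 : C.entropy (q + 1 + 1) ≠ 0 := by linarith
  simp only [trunc]
  field_simp

variable {Ω : Type*} {V : ℕ → Ω → α} {n : ℕ}

/-- One step of the chain. -/
theorem abs_empProc_rest_le [IsFiniteMeasure P] (hn : 1 ≤ n) (q : ℕ) (t : T) (ω : Ω) :
    |empProc P V n (C.rest n q t) ω| ≤ |empProc P V n (C.link n q t) ω|
      + (|empProc P V n (C.drop n q t) ω| + 4 * (C.mesh (q + 1) * C.entropy (q + 2)))
      + |empProc P V n (C.rest n (q + 1) t) ω| := by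
  have e : C.rest n q t
      = fun v => C.link n q t v + (C.restDrop n q t v + C.rest n (q + 1) t v) :=
    funext fun v => C.rest_eq n q t v
  have i1 : Integrable (fun v => C.restDrop n q t v + C.rest n (q + 1) t v) P :=
    (C.integrable_restDrop n q t).add (C.integrable_rest n (q + 1) t)
  rw [e, empProc_add (C.integrable_link n q t) i1,
    empProc_add (C.integrable_restDrop n q t) (C.integrable_rest n (q + 1) t)]
  have h1 := abs_empProc_le_of_le (V := V) (n := n) (C.integrable_restDrop n q t)
    (C.integrable_drop n q t)
    (fun v => Set.indicator_nonneg (fun v _ => sub_nonneg.2 (C.lower_le _ t v)) v)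
    (fun v => Set.indicator_le_indicator (C.sub_lower_le (q + 1) t v)) ω
  have h2 := C.sqrt_mul_integral_drop_le hn q t
  have h3 := abs_add_le (empProc P V n (C.link n q t) ω)
    (empProc P V n (C.restDrop n q t) ω + empProc P V n (C.rest n (q + 1) t) ω)
  have h4 := abs_add_le (empProc P V n (C.restDrop n q t) ω)
    (empProc P V n (C.rest n (q + 1) t) ω)
  linarith

variable [MeasurableSpace Ω] {Q : Measure Ω}

/-- Functions that are dominated by the truncated gap at level `q` and are determined by the first
`q + 1` brackets: outside an event of small probability, the empirical process is at most
`K mesh_q entropy_{q+1}` at all of them. -/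
theorem measure_step [IsProbabilityMeasure Q] [IsProbabilityMeasure P]
    (hV : IsIIDSample Q V P) (hn : 1 ≤ n) (q : ℕ) (h : T → α → ℝ)
    (hm : ∀ t, AEMeasurable (h t) P)
    (hle : ∀ t v, |h t v| ≤ (C.tame n q t).indicator (C.gap q t) v)
    (hcode : ∀ t t', (∀ p < q + 1, C.code p t = C.code p t') → h t = h t')
    {K : ℝ} (hK : 2 ≤ K) :
    Q {ω | ∃ t, K * (C.mesh q * C.entropy (q + 1)) ≤ |empProc P V n (h t) ω|}
      ≤ ENNReal.ofReal (2 * Real.exp (-(K - 2)) * (1 / 2) ^ (q + 1)) := by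
  have hL := C.one_le_entropy q
  have he := C.mesh_pos q
  set L := C.entropy (q + 1) with hLdef
  have hb : ∀ t v, |h t v| ≤ C.trunc n q := fun t v => by
    refine (hle t v).trans ?_
    by_cases hv : v ∈ C.tame n q t
    · rw [Set.indicator_of_mem hv]; exact C.gap_le_of_mem_tame hv
    · rw [Set.indicator_of_notMem hv]; exact C.trunc_nonneg n q
  have hgap : ∀ t v, |h t v| ≤ C.gap q t v := fun t v =>
    (hle t v).trans (Set.indicator_le_self' (fun v _ => C.gap_nonneg q t v) v)
  have hσ : ∀ t, ∫ v, h t v ^ 2 ∂P ≤ C.mesh q ^ 2 := fun t => by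
    refine le_trans ?_ (C.integral_gap_sq q t)
    refine integral_mono_of_nonneg (Eventually.of_forall fun v => sq_nonneg _)
      (C.memLp_gap q t).integrable_sq (Eventually.of_forall fun v => ?_)
    exact sq_le_sq' (by linarith [neg_le_of_abs_le (hgap t v)]) (le_of_abs_le (hgap t v))
  have hlb : 2 * (L / C.mesh q) * C.trunc n q ≤ Real.sqrt n := by
    refine le_of_eq ?_
    simp only [trunc, ← hLdef]
    field_simp
  -- Bernstein with `λ = L / mesh`; the exponent `-(K - 1) L²` absorbs the `exp (L² - q - 1)` codes
  refine (hV.measure_exists_le_abs_empProc hn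
    (fun t (p : Fin (q + 1)) => C.code p t) h
    (fun t t' htt => hcode t t' fun p hp => congrFun htt ⟨p, hp⟩) hm hb hσ
    (div_nonneg (zero_le_one.trans hL) he.le) hlb _).trans (ENNReal.ofReal_le_ofReal ?_)
  have e1 : -(L / C.mesh q) * (K * (C.mesh q * L)) + (L / C.mesh q) ^ 2 * C.mesh q ^ 2
      = -(K - 1) * L ^ 2 := by
    field_simp
    ring
  rw [e1]
  refine (mul_le_mul_of_nonneg_right (C.card_code_le (q + 1)) (by positivity)).trans ?_
  rw [← hLdef, mul_left_comm, ← Real.exp_add, mul_assoc]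
  refine mul_le_mul_of_nonneg_left ?_ zero_le_two
  have e2 : ((1 : ℝ) / 2) ^ (q + 1) ≥ Real.exp (-((q + 1 : ℕ) : ℝ)) := by
    have h1 : Real.exp (-1) ≤ 1 / 2 := by
      rw [Real.exp_neg, ← one_div]
      refine one_div_le_one_div_of_le two_pos ?_
      linarith [Real.add_one_le_exp (1 : ℝ)]
    have h2 : Real.exp (-((q + 1 : ℕ) : ℝ)) = Real.exp (-1) ^ (q + 1) := by
      rw [← Real.exp_nat_mul]; congr 1; ring
    rw [h2]
    exact pow_le_pow_left₀ (Real.exp_pos _).le h1 _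
  refine le_trans ?_ (mul_le_mul_of_nonneg_left e2 (Real.exp_pos _).le)
  rw [← Real.exp_add]
  refine Real.exp_le_exp.2 ?_
  have : 1 ≤ L ^ 2 := one_le_pow₀ hL
  nlinarith

end BracketChain

/-! ### The maximal inequality for a bracketed class -/

namespace BracketChain

variable {α T Ω : Type*} [MeasurableSpace α] {P : Measure α} (C : BracketChain P T)
  {V : ℕ → Ω → α} {n : ℕ}

/-- The part of the envelope that exceeds the first truncation level. -/
def peak (n : ℕ) : α → ℝ := {v | C.trunc n 0 < 2 * C.H v}.indicator C.H

theorem gap_zero (t : T) (v : α) : C.gap 0 t v = 2 * C.H v := by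
  simp only [gap, upper, lower]; ring

theorem aemeasurable_peak (n : ℕ) : AEMeasurable (C.peak n) P :=
  C.aemeasurable_H.indicator₀ (nullMeasurableSet_lt aemeasurable_const
    (C.aemeasurable_H.const_mul 2))

theorem integrable_peak [IsFiniteMeasure P] (n : ℕ) : Integrable (C.peak n) P := by
  refine C.integrable_H.abs.mono' (C.aemeasurable_peak n).aestronglyMeasurable
    (Eventually.of_forall fun v => ?_)
  unfold peak
  rw [Real.norm_eq_abs]
  by_cases hv : v ∈ {v | C.trunc n 0 < 2 * C.H v}
  · rw [Set.indicator_of_mem hv]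
  · rw [Set.indicator_of_notMem hv, abs_zero]; exact abs_nonneg _

theorem sqrt_mul_integral_peak_le [Nonempty T] (hn : 1 ≤ n) :
    Real.sqrt n * ∫ v, C.peak n v ∂P ≤ 2 * (C.δ * C.entropy 1) := by
  obtain ⟨t⟩ := ‹Nonempty T›
  have h1 : (0 : ℝ) < Real.sqrt n := Real.sqrt_pos.2 (by exact_mod_cast hn)
  have h2 := C.δ_pos
  have h3 := C.one_le_entropy 0
  have h4 := C.trunc_pos hn 0
  have := integral_indicator_le C.memLp_H (C.H_nonneg t)
    (S := {v | C.trunc n 0 < 2 * C.H v}) (half_pos h4)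
    (fun v hv => by
      simp only [Set.mem_ofPred_eq] at hv
      linarith) C.integral_H_sq
  refine (mul_le_mul_of_nonneg_left this h1.le).trans (le_of_eq ?_)
  have h5 : C.entropy (0 + 1) ≠ 0 := by linarith
  simp only [trunc, mesh, pow_zero]
  field_simp

/-- The chain, summed over its links. -/
theorem abs_empProc_rest_zero_le [IsFiniteMeasure P] (hn : 1 ≤ n) (t : T) (ω : Ω) {K : ℝ}
    (hlink : ∀ q < n,
      |empProc P V n (C.link n q t) ω| ≤ K * (C.mesh q * C.entropy (q + 1)))
    (hdrop : ∀ q < n,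
      |empProc P V n (C.drop n q t) ω| ≤ K * (C.mesh q * C.entropy (q + 1))) :
    |empProc P V n (C.rest n 0 t) ω|
      ≤ 2 * K * ∑ q ∈ Finset.range n, C.mesh q * C.entropy (q + 1)
        + 4 * ∑ q ∈ Finset.range (n + 1), C.mesh q * C.entropy (q + 1)
        + |empProc P V n (C.rest n n t) ω| := by
  have key : ∀ N ≤ n, |empProc P V n (C.rest n 0 t) ω|
      ≤ 2 * K * ∑ q ∈ Finset.range N, C.mesh q * C.entropy (q + 1)
        + 4 * ∑ q ∈ Finset.range N, C.mesh (q + 1) * C.entropy (q + 2)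
        + |empProc P V n (C.rest n N t) ω| := by
    intro N
    induction N with
    | zero => intro _; simp
    | succ N ih =>
      intro hN
      have h1 := ih (by omega)
      have h2 := C.abs_empProc_rest_le (V := V) hn N t ω
      have h3 := hlink N (by omega)
      have h4 := hdrop N (by omega)
      rw [Finset.sum_range_succ, Finset.sum_range_succ _ N]
      linarith
  have h1 := key n le_rfl
  rw [Finset.sum_range_succ' _ n]
  have := mul_nonneg (C.mesh_pos 0).le (C.entropy_nonneg (0 + 1))
  linarith

/-- After `n` steps the chain is so fine that the remainder is bounded outright. -/
theorem abs_empProc_rest_last_le [IsProbabilityMeasure P] (t : T) (ω : Ω) :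
    |empProc P V n (C.rest n n t) ω| ≤ 2 * C.δ := by
  have hb : ∀ v, |C.rest n n t v| ≤ C.trunc n n := fun v => by
    unfold rest
    by_cases hv : v ∈ C.tame n n t
    · rw [Set.indicator_of_mem hv, abs_of_nonneg (sub_nonneg.2 (C.lower_le n t v))]
      exact (C.sub_lower_le n t v).trans (C.gap_le_of_mem_tame hv)
    · rw [Set.indicator_of_notMem hv, abs_zero]
      exact C.trunc_nonneg n n
  refine (abs_empProc_le_of_bound hb ω).trans ?_
  have h1 : (0 : ℝ) ≤ n := Nat.cast_nonneg n
  have h2 := C.δ_pos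
  have h3 := C.one_le_entropy n
  have e : 2 * Real.sqrt n * C.trunc n n = n * C.mesh n / C.entropy (n + 1) := by
    have h4 : C.entropy (n + 1) ≠ 0 := by linarith
    simp only [trunc]
    field_simp
    rw [Real.sq_sqrt h1]
    ring
  rw [e]
  have h6 : (n : ℝ) * (1 / 2) ^ n ≤ 1 := by
    rw [one_div, inv_pow, ← div_eq_mul_inv, div_le_one (by positivity)]
    exact_mod_cast Nat.lt_two_pow_self.le
  have h7 : n * C.mesh n ≤ 2 * C.δ := by
    simp only [mesh]
    nlinarith
  exact (div_le_self (mul_nonneg h1 (C.mesh_pos n).le) h3).trans h7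

variable [MeasurableSpace Ω] {Q : Measure Ω}

/-- Markov's inequality for the part of the envelope that is too large for Bernstein's. -/
theorem measure_peak [Nonempty T] [IsProbabilityMeasure Q] [IsProbabilityMeasure P]
    (hV : IsIIDSample Q V P) (hn : 1 ≤ n) {K : ℝ} (hK : 0 < K) :
    Q {ω | K * (C.δ * C.entropy 1)
        ≤ (Real.sqrt n)⁻¹ * ∑ i ∈ Finset.range n, C.peak n (V i ω)}
      ≤ ENNReal.ofReal (2 / K) := by
  have hpos : 0 < C.δ * C.entropy 1 :=
    mul_pos C.δ_pos (zero_lt_one.trans_le (C.one_le_entropy 0))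
  obtain ⟨t⟩ := ‹Nonempty T›
  have hs0 : (0 : ℝ) < Real.sqrt n := Real.sqrt_pos.2 (by exact_mod_cast hn)
  have hcomp : ∀ i, Integrable (fun ω => C.peak n (V i ω)) Q := fun i =>
    hV.integrable_comp (C.integrable_peak n) i
  set Y : Ω → ℝ := fun ω => (Real.sqrt n)⁻¹ * ∑ i ∈ Finset.range n, C.peak n (V i ω) with hY
  have hYi : Integrable Y Q := (integrable_finsetSum _ fun i _ => hcomp i).const_mul _
  have hY0 : ∀ ω, 0 ≤ Y ω := fun ω =>
    mul_nonneg (inv_nonneg.2 hs0.le) (Finset.sum_nonneg fun i _ =>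
      Set.indicator_nonneg (fun v _ => C.H_nonneg t v) _)
  have hYint : ∫ ω, Y ω ∂Q ≤ 2 * (C.δ * C.entropy 1) := by
    have : Nonempty T := ⟨t⟩
    refine le_trans (le_of_eq ?_) (C.sqrt_mul_integral_peak_le hn)
    simp only [hY]
    rw [integral_const_mul, integral_finsetSum _ fun i _ => hcomp i,
      Finset.sum_congr rfl fun i _ =>
        hV.integral_comp (C.aemeasurable_peak n).aestronglyMeasurable i,
      Finset.sum_const, Finset.card_range, nsmul_eq_mul, ← mul_assoc]
    congr 1
    rw [inv_mul_eq_div, Real.div_sqrt]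
  have hM := mul_meas_ge_le_integral_of_nonneg (Eventually.of_forall hY0) hYi
    (K * (C.δ * C.entropy 1))
  rw [← ofReal_measureReal]
  refine ENNReal.ofReal_le_ofReal ?_
  rw [le_div_iff₀ hK]
  have : (K * (C.δ * C.entropy 1)) * Q.real {ω | K * (C.δ * C.entropy 1) ≤ Y ω}
      ≤ 2 * (C.δ * C.entropy 1) := hM.trans hYint
  nlinarith

/-- Maximal inequality: the empirical process is, uniformly over the class, of the order of the
bracketing entropy sum `δ ∑_p 2^{-p} s_p`. -/
theorem measure_exists_lt_abs_empProc [IsProbabilityMeasure Q] [IsProbabilityMeasure P]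
    (hV : IsIIDSample Q V P) (hn : 1 ≤ n) {S : ℝ}
    (hS : ∀ N, ∑ p ∈ Finset.range N, (1 / 2) ^ p * C.s p ≤ S) {K : ℝ} (hK : 2 ≤ K) :
    Q {ω | ∃ t, 21 * K * (C.δ * S) < |empProc P V n (C.g t) ω|} ≤ ENNReal.ofReal (42 / K) := by
  rcases isEmpty_or_nonempty T with hT | hT
  · have : {ω | ∃ t, 21 * K * (C.δ * S) < |empProc P V n (C.g t) ω|} = ∅ := by
      ext ω; simp
    rw [this, measure_empty]
    exact zero_le
  have t₀ : T := hT.some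
  have hK0 : 0 < K := by linarith
  set Elink : ℕ → Set Ω := fun q =>
    {ω | ∃ t, K * (C.mesh q * C.entropy (q + 1)) ≤ |empProc P V n (C.link n q t) ω|} with hElink
  set Edrop : ℕ → Set Ω := fun q =>
    {ω | ∃ t, K * (C.mesh q * C.entropy (q + 1)) ≤ |empProc P V n (C.drop n q t) ω|} with hEdrop
  set base : T → α → ℝ := fun t => (C.tame n 0 t).indicator C.H with hbase
  have hbase_meas : ∀ t, AEMeasurable (base t) P := fun t =>
    C.aemeasurable_H.indicator₀ (C.nullMeasurableSet_tame n 0 t)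
  set Ebase : Set Ω :=
    {ω | ∃ t, K * (C.mesh 0 * C.entropy (0 + 1)) ≤ |empProc P V n (base t) ω|} with hEbase
  set Epeak : Set Ω := {ω | K * (C.δ * C.entropy 1)
        ≤ (Real.sqrt n)⁻¹ * ∑ i ∈ Finset.range n, C.peak n (V i ω)} with hEpeak
  set x : ℝ := Real.exp (-(K - 2)) with hx
  have hx0 : 0 < x := Real.exp_pos _
  have mlink : ∀ q, Q (Elink q) ≤ ENNReal.ofReal (2 * x * (1 / 2) ^ (q + 1)) := fun q =>
    C.measure_step hV hn q (C.link n q) (C.aemeasurable_link n q) (C.abs_link_le n q)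
      (fun t t' h => C.link_congr h) hK
  have mdrop : ∀ q, Q (Edrop q) ≤ ENNReal.ofReal (2 * x * (1 / 2) ^ (q + 1)) := fun q =>
    C.measure_step hV hn q (C.drop n q) (C.aemeasurable_drop n q) (C.abs_drop_le n q)
      (fun t t' h => C.drop_congr h) hK
  have mbase : Q Ebase ≤ ENNReal.ofReal (2 * x * (1 / 2) ^ (0 + 1)) := by
    refine C.measure_step hV hn 0 base hbase_meas (fun t v => ?_) (fun t t' _ => rfl) hK
    rw [abs_of_nonneg (Set.indicator_nonneg (fun v _ => C.H_nonneg t v) v)]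
    refine Set.indicator_le_indicator ?_
    rw [C.gap_zero]
    linarith [C.H_nonneg t v]
  have mpeak : Q Epeak ≤ ENNReal.ofReal (2 / K) := C.measure_peak hV hn hK0
  -- on the complement of the exceptional events the chain can be summed
  have hsub : {ω | ∃ t, 21 * K * (C.δ * S) < |empProc P V n (C.g t) ω|}
      ⊆ (⋃ q ∈ Finset.range n, (Elink q ∪ Edrop q)) ∪ (Ebase ∪ Epeak) := by
    intro ω hω
    by_contra hcon
    obtain ⟨t, ht⟩ := hω
    simp only [Set.mem_union, Set.mem_iUnion, not_or, not_exists, Finset.mem_range] at hcon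
    obtain ⟨hq, hb, hp⟩ := hcon
    have g1 : ∀ q < n,
        |empProc P V n (C.link n q t) ω| ≤ K * (C.mesh q * C.entropy (q + 1)) := by
      intro q hqn
      by_contra hc
      exact (hq q hqn).1 ⟨t, (not_le.1 hc).le⟩
    have g2 : ∀ q < n,
        |empProc P V n (C.drop n q t) ω| ≤ K * (C.mesh q * C.entropy (q + 1)) := by
      intro q hqn
      by_contra hc
      exact (hq q hqn).2 ⟨t, (not_le.1 hc).le⟩
    have g3 : |empProc P V n (base t) ω| ≤ K * (C.mesh 0 * C.entropy (0 + 1)) := by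
      by_contra hc
      exact hb ⟨t, (not_le.1 hc).le⟩
    have g4 : (Real.sqrt n)⁻¹ * ∑ i ∈ Finset.range n, C.peak n (V i ω)
        ≤ K * (C.δ * C.entropy 1) := by
      by_contra hc
      exact hp (not_le.1 hc).le
    have hS0 : C.entropy 1 ≤ S := by
      have := hS 1
      simpa [entropy] using this
    have hE1 := C.one_le_entropy 0
    have hδ := C.δ_pos
    have hrest := C.abs_empProc_rest_zero_le (V := V) hn t ω g1 g2
    have hlast := C.abs_empProc_rest_last_le (V := V) (n := n) t ω
    have hs1 := (C.sum_mesh_mul_entropy_le n).trans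
      (mul_le_mul_of_nonneg_left (hS n) (by positivity))
    have hs2 := (C.sum_mesh_mul_entropy_le (n + 1)).trans
      (mul_le_mul_of_nonneg_left (hS (n + 1)) (by positivity))
    have hpk := C.sqrt_mul_integral_peak_le (P := P) hn
    have hcut : |empProc P V n ((C.tame n 0 t)ᶜ.indicator (C.g t)) ω|
        ≤ (Real.sqrt n)⁻¹ * ∑ i ∈ Finset.range n, C.peak n (V i ω)
          + Real.sqrt n * ∫ v, C.peak n v ∂P := by
      refine abs_empProc_le_of_abs_le (C.integrable_peak n) (fun v => ?_) ω
      unfold peak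
      by_cases hv : v ∈ C.tame n 0 t
      · rw [Set.indicator_of_notMem (by simpa using hv), abs_zero]
        exact Set.indicator_nonneg (fun v _ => C.H_nonneg t v) v
      · have hv' : v ∈ {v | C.trunc n 0 < 2 * C.H v} := by
          have : ¬ C.gap 0 t v ≤ C.trunc n 0 := hv
          rw [C.gap_zero] at this
          exact not_le.1 this
        rw [Set.indicator_of_mem (Set.mem_compl hv), Set.indicator_of_mem hv']
        exact C.abs_g_le t v
    -- off the tame points `g t` is below the peak; on them it is the chain started at `-H`
    have hdecomp : C.g t = fun v => (C.tame n 0 t)ᶜ.indicator (C.g t) v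
        + (C.rest n 0 t v + -base t v) := by
      funext v
      simp only [rest, hbase, lower]
      by_cases hv : v ∈ C.tame n 0 t
      · simp [hv]
      · simp [hv]
    have hmeas_cut : AEMeasurable ((C.tame n 0 t)ᶜ.indicator (C.g t)) P :=
      (C.measurable_g t).indicator₀ (C.nullMeasurableSet_tame n 0 t).compl
    have i1 : Integrable ((C.tame n 0 t)ᶜ.indicator (C.g t)) P := by
      refine C.integrable_of_abs_le hmeas_cut fun v => ?_
      have h1 : |(C.tame n 0 t)ᶜ.indicator (C.g t) v| ≤ |C.g t v| := by
        simpa using norm_indicator_le_norm_self (s := (C.tame n 0 t)ᶜ) (C.g t) v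
      linarith [C.abs_g_le t v, C.H_nonneg t v]
    have i2 : Integrable (base t) P :=
      C.integrable_of_abs_le (hbase_meas t)
        (C.abs_indicator_le_two_mul _ t (C.H_nonneg t) fun v => by linarith [C.H_nonneg t v])
    have i3 := C.integrable_rest n 0 t
    have i4 : Integrable (fun v => C.rest n 0 t v + -base t v) P := i3.add i2.neg
    have hG : empProc P V n (C.g t) ω = empProc P V n ((C.tame n 0 t)ᶜ.indicator (C.g t)) ω
        + (empProc P V n (C.rest n 0 t) ω - empProc P V n (base t) ω) := by
      conv_lhs => rw [hdecomp]
      rw [empProc_add i1 i4, empProc_add (h' := fun v => -base t v) i3 i2.neg, empProc_neg]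
      ring
    rw [hG] at ht
    have a1 := abs_add_le (empProc P V n ((C.tame n 0 t)ᶜ.indicator (C.g t)) ω)
      (empProc P V n (C.rest n 0 t) ω - empProc P V n (base t) ω)
    have a2 := abs_sub (empProc P V n (C.rest n 0 t) ω) (empProc P V n (base t) ω)
    have m0 : C.mesh 0 = 2 * C.δ := by simp [mesh]
    rw [m0] at g3
    have d1 : C.δ * C.entropy 1 ≤ C.δ * S := mul_le_mul_of_nonneg_left hS0 hδ.le
    have d2 : C.δ ≤ C.δ * C.entropy 1 := le_mul_of_one_le_right hδ.le hE1
    have d3 : K * (C.δ * C.entropy 1) ≤ K * (C.δ * S) := mul_le_mul_of_nonneg_left d1 hK0.le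
    have d4 : K * (2 * C.δ * C.entropy (0 + 1)) ≤ 2 * (K * (C.δ * S)) := by
      have : K * (2 * C.δ * C.entropy (0 + 1)) = 2 * (K * (C.δ * C.entropy 1)) := by ring_nf
      linarith
    have d5 := mul_le_mul_of_nonneg_left hs1 (by linarith : 0 ≤ 2 * K)
    have d6 : 2 * (C.δ * S) ≤ K * (C.δ * S) := mul_le_mul_of_nonneg_right hK (by linarith)
    nlinarith
  refine (measure_mono hsub).trans ?_
  refine (measure_union_le _ _).trans ((add_le_add (measure_biUnion_finset_le _ _)
    (measure_union_le _ _)).trans ?_)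
  have hsum : ∑ q ∈ Finset.range n, Q (Elink q ∪ Edrop q) ≤ ENNReal.ofReal (4 * x) := by
    have h1 : ∀ q ∈ Finset.range n, Q (Elink q ∪ Edrop q)
        ≤ ENNReal.ofReal (4 * x * (1 / 2) ^ (q + 1)) := fun q _ => by
      refine (measure_union_le _ _).trans ((add_le_add (mlink q) (mdrop q)).trans ?_)
      rw [← ENNReal.ofReal_add (by positivity) (by positivity)]
      exact ENNReal.ofReal_le_ofReal (by linarith)
    refine (Finset.sum_le_sum h1).trans ?_
    rw [← ENNReal.ofReal_sum_of_nonneg fun q _ => by positivity]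
    refine ENNReal.ofReal_le_ofReal ?_
    rw [← Finset.mul_sum]
    refine mul_le_of_le_one_right (by positivity) ?_
    have h2 : ∀ N : ℕ, ∑ q ∈ Finset.range N, (1 / 2 : ℝ) ^ (q + 1) = 1 - (1 / 2) ^ N := by
      intro N
      induction N with
      | zero => simp
      | succ N ih => rw [Finset.sum_range_succ, ih, pow_succ]; ring
    rw [h2]
    have : (0 : ℝ) < (1 / 2) ^ n := by positivity
    linarith
  refine (add_le_add hsum (add_le_add mbase mpeak)).trans ?_
  rw [← ENNReal.ofReal_add (by positivity) (by positivity),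
    ← ENNReal.ofReal_add (by positivity) (by positivity)]
  refine ENNReal.ofReal_le_ofReal ?_
  -- `exp (-(K - 2)) = e² / e^K ≤ 8 / K`
  have hxK : x ≤ 8 / K := by
    rw [le_div_iff₀ hK0]
    have e1 : Real.exp 2 ≤ 8 := by
      have h1 := Real.exp_one_lt_d9
      have h2 : Real.exp 2 = Real.exp 1 * Real.exp 1 := by
        rw [← Real.exp_add]; norm_num
      have h3 := Real.exp_pos 1
      rw [h2]
      nlinarith
    have e2 : x * Real.exp K = Real.exp 2 := by
      rw [hx, ← Real.exp_add]; congr 1; ring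
    have e3 := Real.add_one_le_exp K
    nlinarith
  have : (42 : ℝ) / K = 5 * (8 / K) + 2 / K := by ring
  rw [this]
  linarith

end BracketChain

/-! ### Bracketing numbers and the bracketing integral -/

section Bracketing

variable {α : Type*} [MeasurableSpace α] {P : Measure α}

theorem integral_sq_eq_eLpNorm_sq {f : α → ℝ} (hf : MemLp f 2 P) :
    ∫ v, f v ^ 2 ∂P = (eLpNorm f 2 P).toReal ^ 2 := by
  have h0 : 0 ≤ ∫ v, f v ^ 2 ∂P := integral_nonneg fun v => sq_nonneg _
  rw [hf.eLpNorm_eq_integral_rpow_norm two_ne_zero ENNReal.ofNat_ne_top]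
  simp only [ENNReal.toReal_ofNat, Real.norm_eq_abs, Real.rpow_ofNat, sq_abs]
  rw [ENNReal.toReal_ofReal (Real.rpow_nonneg h0 _), ← Real.rpow_natCast, ← Real.rpow_mul h0]
  norm_num

theorem integral_sq_le_of_eLpNorm_le {f : α → ℝ} (hf : MemLp f 2 P) {c : ℝ} (hc : 0 ≤ c)
    (h : eLpNorm f 2 P ≤ ENNReal.ofReal c) : ∫ v, f v ^ 2 ∂P ≤ c ^ 2 := by
  rw [integral_sq_eq_eLpNorm_sq hf]
  refine pow_le_pow_left₀ ENNReal.toReal_nonneg ?_ 2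
  exact ENNReal.toReal_le_of_le_ofReal hc h

theorem bracketNumber_anti {𝓕 : Set (α → ℝ)} {ε ε' : ℝ} (h : ε ≤ ε') :
    bracketNumber P 𝓕 ε' ≤ bracketNumber P 𝓕 ε := by
  unfold bracketNumber
  refine le_iInf fun m => le_iInf fun hm => ?_
  obtain ⟨L, U, h1, h2⟩ := hm
  exact iInf₂_le m ⟨L, U, fun i => ⟨(h1 i).1, (h1 i).2.1,
    (h1 i).2.2.trans_le (ENNReal.ofReal_le_ofReal h)⟩, h2⟩

/-- A finite bracketing number is attained. -/
theorem exists_brackets {𝓕 : Set (α → ℝ)} {ε : ℝ} (h : bracketNumber P 𝓕 ε ≠ ⊤) :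
    ∃ L U : Fin (bracketNumber P 𝓕 ε).toNat → α → ℝ,
      (∀ i, MemLp (L i) 2 P ∧ MemLp (U i) 2 P ∧ eLpNorm (U i - L i) 2 P < ENNReal.ofReal ε) ∧
      ∀ f ∈ 𝓕, ∃ i, ∀ v, L i v ≤ f v ∧ f v ≤ U i v := by
  obtain ⟨N, hN⟩ := ENat.ne_top_iff_exists.1 h
  rw [← hN, ENat.toNat_natCast]
  by_contra hcon
  have key : ((N + 1 : ℕ) : ℕ∞) ≤ bracketNumber P 𝓕 ε := by
    rw [bracketNumber]
    refine le_iInf fun m => le_iInf fun hm => ?_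
    have h1 : bracketNumber P 𝓕 ε ≤ m := iInf₂_le m hm
    rw [← hN, Nat.cast_le] at h1
    have h2 : N ≠ m := by
      rintro rfl
      exact hcon hm
    exact Nat.cast_le.2 (by omega)
  rw [← hN, Nat.cast_le] at key
  omega

/-- The integrand of the bracketing integral. -/
def entropyRoot (P : Measure α) (𝓕 : Set (α → ℝ)) (ε : ℝ) : ℝ≥0∞ :=
  (1 + (ENNReal.log (bracketNumber P 𝓕 ε : ℝ≥0∞)).toENNReal) ^ (1 / 2 : ℝ)

theorem entropyRoot_anti {𝓕 : Set (α → ℝ)} {ε ε' : ℝ} (h : ε ≤ ε') :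
    entropyRoot P 𝓕 ε' ≤ entropyRoot P 𝓕 ε := by
  refine ENNReal.rpow_le_rpow (add_le_add le_rfl ?_) (by norm_num)
  exact EReal.toENNReal_le_toENNReal
    (ENNReal.log_le_log (ENat.toENNReal_le.2 (bracketNumber_anti h)))

theorem entropyRoot_eq {𝓕 : Set (α → ℝ)} {ε : ℝ} (h : bracketNumber P 𝓕 ε ≠ ⊤) :
    entropyRoot P 𝓕 ε
      = ENNReal.ofReal (Real.sqrt (1 + Real.log (bracketNumber P 𝓕 ε).toNat)) := by
  obtain ⟨N, hN⟩ := ENat.ne_top_iff_exists.1 h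
  unfold entropyRoot
  rw [← hN, ENat.toNat_natCast]
  have hlog : (ENNReal.log ((N : ℕ∞) : ℝ≥0∞)).toENNReal = ENNReal.ofReal (Real.log N) := by
    rw [ENat.toENNReal_coe, ← ENNReal.ofReal_natCast, ENNReal.log_ofReal]
    rcases Nat.eq_zero_or_pos N with rfl | hpos
    · simp
    · rw [if_neg (not_le.2 (by exact_mod_cast hpos)), EReal.real_coe_toENNReal]
  have h0 : 0 ≤ Real.log N := Real.log_natCast_nonneg N
  rw [hlog, ← ENNReal.ofReal_one, ← ENNReal.ofReal_add zero_le_one h0,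
    ENNReal.ofReal_rpow_of_nonneg (by positivity) (by norm_num), Real.sqrt_eq_rpow]

theorem bracketNumber_ne_top {𝓕 : Set (α → ℝ)} {δ : ℝ} (h : bracketIntegral P 𝓕 δ ≠ ⊤)
    {ε : ℝ} (hε : 0 < ε) (hεδ : ε ≤ δ) : bracketNumber P 𝓕 ε ≠ ⊤ := by
  intro htop
  refine h (top_unique ?_)
  have h1 : entropyRoot P 𝓕 ε = ⊤ := by
    unfold entropyRoot
    rw [htop]
    simp
  have h2 : ∫⁻ _x in Set.Ioo 0 ε, (⊤ : ℝ≥0∞) ≤ ∫⁻ x in Set.Ioo 0 ε, entropyRoot P 𝓕 x := by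
    refine setLIntegral_mono' measurableSet_Ioo fun x hx => ?_
    rw [← h1]
    exact entropyRoot_anti hx.2.le
  have h3 : ∫⁻ _x in Set.Ioo 0 ε, (⊤ : ℝ≥0∞) = ⊤ := by
    rw [setLIntegral_const, Real.volume_Ioo, sub_zero]
    exact ENNReal.top_mul (by simpa using hε)
  rw [← h3]
  exact h2.trans (lintegral_mono_set (Set.Ioo_subset_Ioo_right hεδ))

/-- The dyadic entropy sums are at most twice the bracketing integral. -/
theorem sum_entropy_le_bracketIntegral {𝓕 : Set (α → ℝ)} {δ J : ℝ} (hδ : 0 < δ) (hJ : 0 ≤ J)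
    (h : bracketIntegral P 𝓕 δ ≤ ENNReal.ofReal J) (N : ℕ) :
    ∑ p ∈ Finset.range N, (1 / 2) ^ p * δ
      * Real.sqrt (1 + Real.log (bracketNumber P 𝓕 ((1 / 2) ^ p * δ)).toNat) ≤ 2 * J := by
  have hne : bracketIntegral P 𝓕 δ ≠ ⊤ := ne_top_of_le_ne_top ENNReal.ofReal_ne_top h
  have hpow : ∀ p : ℕ, (0 : ℝ) < (1 / 2) ^ p := fun p => by positivity
  have hpow1 : ∀ p : ℕ, (1 / 2 : ℝ) ^ p ≤ 1 := fun p =>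
    pow_le_one₀ (by norm_num) (by norm_num)
  have hfin : ∀ p : ℕ, bracketNumber P 𝓕 ((1 / 2) ^ p * δ) ≠ ⊤ := fun p =>
    bracketNumber_ne_top hne (mul_pos (hpow p) hδ) (mul_le_of_le_one_left hδ.le (hpow1 p))
  set I : ℕ → Set ℝ := fun p => Set.Ioo ((1 / 2) ^ (p + 1) * δ) ((1 / 2) ^ p * δ) with hI
  have hdisj : ∀ p q : ℕ, p < q → Disjoint (I p) (I q) := by
    intro p q hpq
    refine Set.disjoint_left.2 fun x hx hx' => ?_
    have h1 : ((1 : ℝ) / 2) ^ q ≤ (1 / 2) ^ (p + 1) :=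
      pow_le_pow_of_le_one (by norm_num) (by norm_num) hpq
    have h2 := mul_le_mul_of_nonneg_right h1 hδ.le
    exact absurd (hx.1.trans hx'.2) (not_lt.2 h2)
  have hpd : ((Finset.range N : Finset ℕ) : Set ℕ).PairwiseDisjoint I := by
    intro p _ q _ hpq
    rcases lt_or_gt_of_ne hpq with h | h
    · exact hdisj p q h
    · exact (hdisj q p h).symm
  have hsub : (⋃ p ∈ Finset.range N, I p) ⊆ Set.Ioo 0 δ := by
    refine Set.iUnion₂_subset fun p _ x hx => ⟨?_, ?_⟩
    · exact (mul_pos (hpow (p + 1)) hδ).trans hx.1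
    · exact hx.2.trans_le (mul_le_of_le_one_left hδ.le (hpow1 p))
  have hle := (lintegral_mono_set (μ := volume) (f := entropyRoot P 𝓕) hsub).trans h
  rw [lintegral_biUnion_finset hpd fun _ _ => measurableSet_Ioo] at hle
  set r : ℕ → ℝ := fun p =>
    Real.sqrt (1 + Real.log (bracketNumber P 𝓕 ((1 / 2) ^ p * δ)).toNat) with hr
  have hterm : ∀ p ∈ Finset.range N, ENNReal.ofReal (r p * ((1 / 2) ^ (p + 1) * δ))
      ≤ ∫⁻ x in I p, entropyRoot P 𝓕 x := by
    intro p _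
    have h1 : ∫⁻ _x in I p, ENNReal.ofReal (r p) ≤ ∫⁻ x in I p, entropyRoot P 𝓕 x := by
      refine setLIntegral_mono' measurableSet_Ioo fun x hx => ?_
      rw [hr, ← entropyRoot_eq (hfin p)]
      exact entropyRoot_anti hx.2.le
    refine le_trans (le_of_eq ?_) h1
    rw [setLIntegral_const, Real.volume_Ioo, ENNReal.ofReal_mul (Real.sqrt_nonneg _)]
    congr 2
    rw [pow_succ]
    ring
  have hsum := (Finset.sum_le_sum hterm).trans hle
  rw [← ENNReal.ofReal_sum_of_nonneg fun p _ =>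
    mul_nonneg (Real.sqrt_nonneg _) (mul_pos (hpow _) hδ).le,
    ENNReal.ofReal_le_ofReal_iff hJ] at hsum
  have : ∑ p ∈ Finset.range N, (1 / 2) ^ p * δ * r p
      = 2 * ∑ p ∈ Finset.range N, r p * ((1 / 2) ^ (p + 1) * δ) := by
    rw [Finset.mul_sum]
    refine Finset.sum_congr rfl fun p _ => ?_
    rw [pow_succ]
    ring
  rw [this]
  linarith

end Bracketing

/-! ### Products of a bracketed class with bounded weights -/

section ProductClass

variable {α : Type*} [MeasurableSpace α] {P : Measure α}

theorem memLp_mul_of_ae_abs_le {f w : α → ℝ} (hf : MemLp f 2 P) (hw : AEMeasurable w P) {B : ℝ}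
    (hB : ∀ᵐ v ∂P, |w v| ≤ B) : MemLp (fun v => f v * w v) 2 P := by
  refine hf.of_le_mul (c := B)
    (hf.aestronglyMeasurable.aemeasurable.mul hw).aestronglyMeasurable ?_
  filter_upwards [hB] with v hv
  rw [norm_mul, mul_comm]
  exact mul_le_mul_of_nonneg_right hv (norm_nonneg _)

theorem integral_mul_sq_le {f w : α → ℝ} (hf : MemLp f 2 P) {B c : ℝ}
    (hB : ∀ᵐ v ∂P, |w v| ≤ B) (hc : ∫ v, f v ^ 2 ∂P ≤ c ^ 2) :
    ∫ v, (f v * w v) ^ 2 ∂P ≤ (B * c) ^ 2 := by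
  have : ∫ v, (f v * w v) ^ 2 ∂P ≤ ∫ v, B ^ 2 * f v ^ 2 ∂P := by
    refine integral_mono_of_nonneg (Eventually.of_forall fun v => sq_nonneg _)
      (hf.integrable_sq.const_mul _) ?_
    filter_upwards [hB] with v hv
    have h1 : w v ^ 2 ≤ B ^ 2 := sq_le_sq' (by linarith [neg_le_of_abs_le hv]) (le_of_abs_le hv)
    have h2 := mul_le_mul_of_nonneg_left h1 (sq_nonneg (f v))
    simp only [mul_pow]
    linarith
  refine this.trans ?_
  rw [integral_const_mul, mul_pow]
  exact mul_le_mul_of_nonneg_left hc (sq_nonneg B)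

theorem ae_abs_le_of_eLpNorm_top_le {w : α → ℝ} {B : ℝ} (hB : 0 ≤ B)
    (h : eLpNorm w ⊤ P ≤ ENNReal.ofReal B) : ∀ᵐ v ∂P, |w v| ≤ B := by
  rw [eLpNorm_exponent_top] at h
  filter_upwards [ae_le_eLpNormEssSup (f := w) (μ := P)] with v hv
  have := hv.trans h
  rw [Real.enorm_eq_ofReal_abs, ENNReal.ofReal_le_ofReal_iff hB] at this
  exact this

/-- The brackets of the products `f w_i`, `f ∈ 𝓕`. A bracket `[L, U]` of `f` gives the bracket
`[L w⁺ - U w⁻, U w⁺ - L w⁻]` of `f w`, of width `(U - L) |w|`; the envelope is `F sup_i |w_i|`. -/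
def productChain [IsProbabilityMeasure P] {I : Type} [Fintype I] (𝓕 : Set (α → ℝ))
    (hm : ∀ f ∈ 𝓕, Measurable f) (F : α → ℝ) (hF : MemLp F 2 P)
    (hF0 : 0 < (eLpNorm F 2 P).toReal) (hle : ∀ f ∈ 𝓕, ∀ v, |f v| ≤ F v)
    (w : I → α → ℝ) (hw : ∀ i, Measurable (w i)) (B : ℝ) (hB : 1 ≤ B)
    (hwB : ∀ i, ∀ᵐ v ∂P, |w i v| ≤ B)
    (hfin : bracketIntegral P 𝓕 (eLpNorm F 2 P).toReal ≠ ⊤) : BracketChain P (𝓕 × I) :=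
  have hwB' : ∀ᵐ v ∂P, |‖fun i => w i v‖| ≤ B := by
    filter_upwards [ae_all_iff.2 hwB] with v hv
    rw [abs_of_nonneg (norm_nonneg _)]
    exact (pi_norm_le_iff_of_nonneg (zero_le_one.trans hB)).2 hv
  have hwm : Measurable fun v => ‖fun i => w i v‖ :=
    measurable_norm.comp (measurable_pi_lambda _ hw)
  have hpos : ∀ i, ∀ᵐ v ∂P, |max (w i v) 0| ≤ B := fun i => by
    filter_upwards [hwB i] with v hv
    rw [abs_of_nonneg (le_max_right _ _)]
    exact max_le (le_of_abs_le hv) (zero_le_one.trans hB)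
  have hneg : ∀ i, ∀ᵐ v ∂P, |max (-w i v) 0| ≤ B := fun i => by
    filter_upwards [hwB i] with v hv
    rw [abs_of_nonneg (le_max_right _ _)]
    exact max_le (neg_le.1 (neg_le_of_abs_le hv)) (zero_le_one.trans hB)
  have hmpos : ∀ i, AEMeasurable (fun v => max (w i v) 0) P := fun i =>
    ((hw i).max measurable_const).aemeasurable
  have hmneg : ∀ i, AEMeasurable (fun v => max (-w i v) 0) P := fun i =>
    ((hw i).neg.max measurable_const).aemeasurable
  have hne : ∀ p : ℕ, bracketNumber P 𝓕 ((1 / 2) ^ p * (eLpNorm F 2 P).toReal) ≠ ⊤ := fun p =>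
    bracketNumber_ne_top hfin (mul_pos (by positivity) hF0)
      (mul_le_of_le_one_left hF0.le (pow_le_one₀ (by norm_num) (by norm_num)))
  let L := fun p => (exists_brackets (hne p)).choose
  let U := fun p => (exists_brackets (hne p)).choose_spec.choose
  have hLU : ∀ p, _ := fun p => (exists_brackets (hne p)).choose_spec.choose_spec
  { g := fun t v => t.1.1 v * w t.2 v
    H := fun v => F v * ‖fun i => w i v‖
    δ := B * (eLpNorm F 2 P).toReal
    δ_pos := mul_pos (zero_lt_one.trans_le hB) hF0
    measurable_g := fun t => ((hm _ t.1.2).mul (hw t.2)).aemeasurable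
    memLp_H := memLp_mul_of_ae_abs_le hF hwm.aemeasurable hwB'
    integral_H_sq := integral_mul_sq_le hF hwB' (integral_sq_eq_eLpNorm_sq hF).le
    abs_g_le := fun t v => by
      rw [abs_mul]
      exact mul_le_mul (hle _ t.1.2 v) (norm_le_pi_norm (fun i => w i v) t.2) (abs_nonneg _)
        ((abs_nonneg _).trans (hle _ t.1.2 v))
    κ := fun p => Fin (bracketNumber P 𝓕 ((1 / 2) ^ p * (eLpNorm F 2 P).toReal)).toNat × I
    fintype_κ := fun p => inferInstance
    code := fun p t => (((hLU p).2 t.1.1 t.1.2).choose, t.2)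
    lo := fun p a v => L p a.1 v * max (w a.2 v) 0 - U p a.1 v * max (-w a.2 v) 0
    up := fun p a v => U p a.1 v * max (w a.2 v) 0 - L p a.1 v * max (-w a.2 v) 0
    memLp_lo := fun p a =>
      (memLp_mul_of_ae_abs_le ((hLU p).1 a.1).1 (hmpos a.2) (hpos a.2)).sub
        (memLp_mul_of_ae_abs_le ((hLU p).1 a.1).2.1 (hmneg a.2) (hneg a.2))
    memLp_up := fun p a =>
      (memLp_mul_of_ae_abs_le ((hLU p).1 a.1).2.1 (hmpos a.2) (hpos a.2)).sub
        (memLp_mul_of_ae_abs_le ((hLU p).1 a.1).1 (hmneg a.2) (hneg a.2))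
    lo_le := fun p t v => by
      have h := ((hLU p).2 t.1.1 t.1.2).choose_spec v
      have h1 := mul_le_mul_of_nonneg_right h.1 (le_max_right (w t.2 v) 0)
      have h2 := mul_le_mul_of_nonneg_right h.2 (le_max_right (-w t.2 v) 0)
      have h3 : w t.2 v = max (w t.2 v) 0 - max (-w t.2 v) 0 := by
        rcases le_total (w t.2 v) 0 with h | h <;> simp [h]
      have h4 : t.1.1 v * w t.2 v
          = t.1.1 v * max (w t.2 v) 0 - t.1.1 v * max (-w t.2 v) 0 := by
        rw [← mul_sub, ← h3]
      rw [h4]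
      exact sub_le_sub h1 h2
    le_up := fun p t v => by
      have h := ((hLU p).2 t.1.1 t.1.2).choose_spec v
      have h1 := mul_le_mul_of_nonneg_right h.2 (le_max_right (w t.2 v) 0)
      have h2 := mul_le_mul_of_nonneg_right h.1 (le_max_right (-w t.2 v) 0)
      have h3 : w t.2 v = max (w t.2 v) 0 - max (-w t.2 v) 0 := by
        rcases le_total (w t.2 v) 0 with h | h <;> simp [h]
      have h4 : t.1.1 v * w t.2 v
          = t.1.1 v * max (w t.2 v) 0 - t.1.1 v * max (-w t.2 v) 0 := by
        rw [← mul_sub, ← h3]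
      rw [h4]
      exact sub_le_sub h1 h2
    width := fun p a => by
      have h := (hLU p).1 a.1
      have hsub : MemLp (fun v => U p a.1 v - L p a.1 v) 2 P := h.2.1.sub h.1
      have h1 := integral_sq_le_of_eLpNorm_le hsub (by positivity) h.2.2.le
      have habs : ∀ᵐ v ∂P, |(|w a.2 v|)| ≤ B := by
        filter_upwards [hwB a.2] with v hv
        rwa [abs_abs]
      have h2 := integral_mul_sq_le hsub habs h1
      refine le_trans (le_of_eq ?_) (h2.trans (le_of_eq (by ring)))
      refine integral_congr_ae (Eventually.of_forall fun v => ?_)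
      have h3 : |w a.2 v| = max (w a.2 v) 0 + max (-w a.2 v) 0 := by
        rcases le_total (w a.2 v) 0 with h | h
        · simp [h, abs_of_nonpos h]
        · simp [h, abs_of_nonneg h]
      simp only [h3]
      ring
    s := fun p => Real.sqrt (1 + Real.log (Fintype.card I) + Real.log
      (bracketNumber P 𝓕 ((1 / 2) ^ p * (eLpNorm F 2 P).toReal)).toNat)
    one_le_s := fun p => by
      have h1 := Real.log_natCast_nonneg (Fintype.card I)
      have h2 := Real.log_natCast_nonneg
        (bracketNumber P 𝓕 ((1 / 2) ^ p * (eLpNorm F 2 P).toReal)).toNat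
      exact Real.one_le_sqrt.2 (by linarith)
    card_le := fun p => by
      have h1 := Real.log_natCast_nonneg (Fintype.card I)
      have h2 := Real.log_natCast_nonneg
        (bracketNumber P 𝓕 ((1 / 2) ^ p * (eLpNorm F 2 P).toReal)).toNat
      rw [Real.sq_sqrt (by linarith), Fintype.card_prod, Fintype.card_fin]
      have hexp : ∀ m : ℕ, (m : ℝ) ≤ Real.exp (Real.log m) := fun m => Real.le_exp_log _
      have e : ∀ a b : ℝ, 1 + a + b - 1 = b + a := fun a b => by ring
      rw [e, Real.exp_add]
      push_cast
      exact mul_le_mul (hexp _) (hexp _) (Nat.cast_nonneg _) (Real.exp_pos _).le }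

variable {Ω : Type*} [MeasurableSpace Ω] {Q : Measure Ω} {V : ℕ → Ω → α} {n : ℕ}

/-- Maximal inequality for the products `f w_i`, `f ∈ 𝓕`, with `k ≥ 2` weights bounded by `B`:
their empirical process is uniformly of the order `(log k)^{1/2} J B`. -/
theorem IsIIDSample.measure_exists_lt_abs_empProc_mul [IsProbabilityMeasure Q]
    [IsProbabilityMeasure P] (hV : IsIIDSample Q V P) (hn : 1 ≤ n) {I : Type} [Fintype I]
    (hI : 2 ≤ Fintype.card I) {𝓕 : Set (α → ℝ)} (hm : ∀ f ∈ 𝓕, Measurable f) {F : α → ℝ}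
    (hF : MemLp F 2 P) (hle : ∀ f ∈ 𝓕, ∀ v, |f v| ≤ F v) {w : I → α → ℝ}
    (hw : ∀ i, Measurable (w i)) {B : ℝ} (hB : 1 ≤ B) (hwB : ∀ i, ∀ᵐ v ∂P, |w i v| ≤ B)
    {J : ℝ} (hJ0 : 0 ≤ J)
    (hJ : bracketIntegral P 𝓕 (eLpNorm F 2 P).toReal ≤ ENNReal.ofReal J) {K : ℝ} (hK : 2 ≤ K) :
    Q {ω | ∃ f ∈ 𝓕, ∃ i, 84 * K * (Real.sqrt (Real.log (Fintype.card I)) * J * B)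
        < |empProc P V n (fun v => f v * w i v) ω|} ≤ ENNReal.ofReal (42 / K) := by
  rcases (ENNReal.toReal_nonneg (a := eLpNorm F 2 P)).eq_or_lt with h0 | hpos
  · -- the envelope vanishes almost surely, and with it the empirical process
    have hF0 : F =ᵐ[P] 0 := by
      have h1 : eLpNorm F 2 P = 0 := by
        rcases (ENNReal.toReal_eq_zero_iff _).1 h0.symm with h | h
        · exact h
        · exact absurd h hF.2.ne
      exact (eLpNorm_eq_zero_iff hF.1 two_ne_zero).1 h1
    have hsample : ∀ᵐ ω ∂Q, ∀ i, F (V i ω) = 0 := ae_all_iff.2 fun i => by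
      have h1 : ∀ᵐ v ∂(Q.map (V i)), F v = 0 := by rw [hV.map_eq i]; exact hF0
      exact ae_of_ae_map (hV.measurable i).aemeasurable h1
    have hzero : ∀ f ∈ 𝓕, ∀ v, F v = 0 → f v = 0 := fun f hf v hv =>
      abs_nonpos_iff.1 (hv ▸ hle f hf v)
    refine (le_of_eq ?_).trans (zero_le (a := ENNReal.ofReal (42 / K)))
    refine measure_mono_null (fun ω hω => ?_) (ae_iff.1 hsample)
    simp only [Set.mem_ofPred_eq] at hω ⊢
    intro hall
    obtain ⟨f, hf, i, hlt⟩ := hω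
    have hint : ∫ v, f v * w i v ∂P = 0 := by
      refine integral_eq_zero_of_ae ?_
      filter_upwards [hF0] with v hv
      rw [hzero f hf v hv, zero_mul]
      rfl
    have hG : empProc P V n (fun v => f v * w i v) ω = 0 := by
      unfold empProc
      rw [hint, Finset.sum_eq_zero, mul_zero]
      intro l _
      show f (V l ω) * w i (V l ω) - 0 = 0
      rw [hzero f hf _ (hall l), zero_mul, sub_zero]
    rw [hG, abs_zero] at hlt
    have : 0 ≤ 84 * K * (Real.sqrt (Real.log (Fintype.card I)) * J * B) := by
      have := Real.sqrt_nonneg (Real.log (Fintype.card I))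
      positivity
    linarith
  · have hfin := ne_top_of_le_ne_top ENNReal.ofReal_ne_top hJ
    set C := productChain 𝓕 hm F hF hpos hle w hw B hB hwB hfin with hC
    set d := (eLpNorm F 2 P).toReal with hd
    set ℓ := Real.log (Fintype.card I) with hℓ
    have hℓ1 : 1 / 2 ≤ ℓ := by
      have h1 := Real.log_two_gt_d9
      have h2 : Real.log 2 ≤ ℓ := Real.log_le_log two_pos (by exact_mod_cast hI)
      linarith
    have hS : ∀ N, ∑ p ∈ Finset.range N, (1 / 2) ^ p * C.s p ≤ 4 * Real.sqrt ℓ * J / d := by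
      intro N
      rw [le_div_iff₀ hpos, Finset.sum_mul]
      have h1 := sum_entropy_le_bracketIntegral hpos hJ0 hJ N
      have h2 : ∀ p ∈ Finset.range N, (1 / 2) ^ p * C.s p * d ≤ 2 * Real.sqrt ℓ
          * ((1 / 2) ^ p * d
            * Real.sqrt (1 + Real.log (bracketNumber P 𝓕 ((1 / 2) ^ p * d)).toNat)) := by
        intro p _
        have h3 := Real.log_natCast_nonneg (bracketNumber P 𝓕 ((1 / 2) ^ p * d)).toNat
        set m := Real.log (bracketNumber P 𝓕 ((1 / 2) ^ p * d)).toNat with hm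
        -- `1 + log k + log N ≤ 4 log k (1 + log N)` as `log k ≥ 1 / 2`
        have h4 : C.s p ≤ 2 * Real.sqrt ℓ * Real.sqrt (1 + m) := by
          have e : 2 * Real.sqrt ℓ * Real.sqrt (1 + m) = Real.sqrt (4 * ℓ * (1 + m)) := by
            rw [Real.sqrt_mul (by linarith), Real.sqrt_mul (by norm_num)]
            have : Real.sqrt 4 = 2 := by
              rw [show (4 : ℝ) = 2 ^ 2 by norm_num, Real.sqrt_sq zero_le_two]
            rw [this]
          rw [e]
          exact Real.sqrt_le_sqrt (show 1 + ℓ + m ≤ 4 * ℓ * (1 + m) by nlinarith)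
        have h5 := mul_le_mul_of_nonneg_left h4
          (by positivity : (0 : ℝ) ≤ (1 / 2) ^ p * d)
        linarith
      refine (Finset.sum_le_sum h2).trans ?_
      rw [← Finset.mul_sum]
      have := mul_le_mul_of_nonneg_left h1 (by positivity : 0 ≤ 2 * Real.sqrt ℓ)
      linarith
    refine (measure_mono fun ω hω => ?_).trans (C.measure_exists_lt_abs_empProc hV hn hS hK)
    simp only [Set.mem_ofPred_eq] at hω ⊢
    obtain ⟨f, hf, i, hlt⟩ := hω
    refine ⟨(⟨f, hf⟩, i), lt_of_eq_of_lt ?_ hlt⟩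
    have e : C.δ = B * d := rfl
    rw [e]
    field_simp
    ring

end ProductClass

/-! ### Vector and operator norms -/

section Norms

variable {ι : Type*} [Fintype ι] {r : ℝ≥0∞}

theorem vecNorm_nonneg [Fact (1 ≤ r)] (a : ι → ℝ) : 0 ≤ vecNorm r a := norm_nonneg _

theorem vecNorm_add_le [Fact (1 ≤ r)] (a b : ι → ℝ) :
    vecNorm r (a + b) ≤ vecNorm r a + vecNorm r b := by
  unfold vecNorm
  rw [WithLp.toLp_add]
  exact norm_add_le _ _

theorem vecNorm_smul [Fact (1 ≤ r)] (c : ℝ) (a : ι → ℝ) :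
    vecNorm r (c • a) = |c| * vecNorm r a := by
  unfold vecNorm
  rw [WithLp.toLp_smul, norm_smul, Real.norm_eq_abs]

theorem vecNorm_neg [Fact (1 ≤ r)] (a : ι → ℝ) : vecNorm r (-a) = vecNorm r a := by
  unfold vecNorm
  rw [WithLp.toLp_neg, norm_neg]

theorem vecNorm_zero [Fact (1 ≤ r)] : vecNorm r (0 : ι → ℝ) = 0 := by
  unfold vecNorm
  rw [WithLp.toLp_zero, norm_zero]

/-- `‖a‖_r ≤ k^{1/r} max_i |a_i|`. -/
theorem vecNorm_le_of_abs_le [Fact (1 ≤ r)] {a : ι → ℝ} {c : ℝ} (hc : 0 ≤ c)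
    (h : ∀ i, |a i| ≤ c) : vecNorm r a ≤ (Fintype.card ι : ℝ) ^ (1 / r).toReal * c := by
  have h1 := (PiLp.antilipschitzWith_ofLp r fun _ : ι => ℝ).le_mul_dist (WithLp.toLp r a) 0
  rw [dist_zero_right, WithLp.ofLp_zero, dist_zero_right] at h1
  unfold vecNorm
  refine h1.trans ?_
  simp only [NNReal.coe_rpow, NNReal.coe_natCast]
  exact mul_le_mul_of_nonneg_left ((pi_norm_le_iff_of_nonneg hc).2 h) (by positivity)

theorem bddAbove_matNorm_set [Fact (1 ≤ r)] (A : Matrix ι ι ℝ) :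
    BddAbove {t : ℝ | ∃ a : ι → ℝ, vecNorm r a = 1 ∧ t = vecNorm r (A *ᵥ a)} := by
  let e := WithLp.linearEquiv r ℝ (ι → ℝ)
  let f : PiLp r (fun _ : ι => ℝ) →ₗ[ℝ] PiLp r (fun _ : ι => ℝ) :=
    e.symm.toLinearMap ∘ₗ A.mulVecLin ∘ₗ e.toLinearMap
  refine ⟨‖LinearMap.toContinuousLinearMap f‖, ?_⟩
  rintro t ⟨a, ha, rfl⟩
  have h := (LinearMap.toContinuousLinearMap f).le_opNorm (WithLp.toLp r a)
  have h1 : ‖(WithLp.toLp r a : PiLp r fun _ : ι => ℝ)‖ = 1 := ha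
  rw [h1, mul_one] at h
  exact h

theorem vecNorm_mulVec_le [Fact (1 ≤ r)] (A : Matrix ι ι ℝ) (a : ι → ℝ) :
    vecNorm r (A *ᵥ a) ≤ matNorm r A * vecNorm r a := by
  rcases (vecNorm_nonneg (r := r) a).eq_or_lt with h | h
  · have h0 : a = 0 := by
      have h1 : (WithLp.toLp r a : PiLp r fun _ : ι => ℝ) = 0 := norm_eq_zero.1 h.symm
      funext i
      exact congrArg (fun x : PiLp r (fun _ : ι => ℝ) => x i) h1
    rw [h0, Matrix.mulVec_zero, vecNorm_zero, mul_zero]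
  · have h1 : vecNorm r (A *ᵥ ((vecNorm r a)⁻¹ • a)) ≤ matNorm r A := by
      refine le_csSup (bddAbove_matNorm_set A) ⟨_, ?_, rfl⟩
      rw [vecNorm_smul, abs_of_pos (inv_pos.2 h), inv_mul_cancel₀ h.ne']
    rw [Matrix.mulVec_smul, vecNorm_smul, abs_of_pos (inv_pos.2 h), inv_mul_le_iff₀ h] at h1
    linarith

variable [DecidableEq ι]

/-- A matrix `W` near an invertible `S` distorts the norm by at most a factor `2 C`, where `C`
bounds `S` and its inverse. -/
theorem vecNorm_mulVec_equiv [Fact (1 ≤ r)] {S W : Matrix ι ι ℝ} {C : ℝ} (hC : 1 ≤ C)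
    (hS : matNorm r S ≤ C) (hu : IsUnit S) (hSi : matNorm r S⁻¹ ≤ C)
    (hW : matNorm r (W - S) ≤ 1 / (2 * C)) (a : ι → ℝ) :
    vecNorm r (W *ᵥ a) ≤ 2 * C * vecNorm r a ∧ vecNorm r a ≤ 2 * C * vecNorm r (W *ᵥ a) := by
  have h0 := vecNorm_nonneg (r := r) a
  have hC0 : 0 < C := by linarith
  have hd := (vecNorm_mulVec_le (r := r) (W - S) a).trans (mul_le_mul_of_nonneg_right hW h0)
  have hs := (vecNorm_mulVec_le (r := r) S a).trans (mul_le_mul_of_nonneg_right hS h0)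
  have e1 : W *ᵥ a = S *ᵥ a + (W - S) *ᵥ a := by
    rw [← Matrix.add_mulVec, add_sub_cancel]
  have e2 : S *ᵥ a = W *ᵥ a + -((W - S) *ᵥ a) := by rw [e1]; abel
  have e3 : a = S⁻¹ *ᵥ (S *ᵥ a) := by
    rw [Matrix.mulVec_mulVec, Matrix.nonsing_inv_mul _ ((Matrix.isUnit_iff_isUnit_det S).1 hu),
      Matrix.one_mulVec]
  have t1 := vecNorm_add_le (r := r) (S *ᵥ a) ((W - S) *ᵥ a)
  have t2 := vecNorm_add_le (r := r) (W *ᵥ a) (-((W - S) *ᵥ a))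
  rw [← e1] at t1
  rw [← e2, vecNorm_neg] at t2
  have t3 := (vecNorm_mulVec_le (r := r) S⁻¹ (S *ᵥ a)).trans
    (mul_le_mul_of_nonneg_right hSi (vecNorm_nonneg _))
  rw [← e3] at t3
  have hsmall : 1 / (2 * C) * vecNorm r a ≤ C * vecNorm r a := by
    refine mul_le_mul_of_nonneg_right ?_ h0
    rw [div_le_iff₀ (by positivity)]
    nlinarith
  have hhalf : C * (1 / (2 * C) * vecNorm r a) = vecNorm r a / 2 := by field_simp
  constructor
  · linarith
  · have := mul_le_mul_of_nonneg_left (t2.trans (add_le_add le_rfl hd)) hC0.le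
    rw [mul_add, hhalf] at this
    linarith

end Norms

/-! ### Hausdorff distances -/

section Hausdorff

variable {E : Type*} [NormedAddCommGroup E]

theorem dirHausdorff_eq_zero_of_subset {A B : Set E} (h : A ⊆ B) : dirHausdorff A B = 0 := by
  refine le_antisymm (iSup₂_le fun a ha => ?_) zero_le
  refine (iInf₂_le a (h ha)).trans ?_
  simp

end Hausdorff

/-! ### Uniform comparison of the sample and population criteria -/

namespace SieveModel

variable {𝒥 dx : ℕ} {dz : Fin 𝒥 → ℕ} {𝓑 Ω : Type*} [NormedAddCommGroup 𝓑]
  [NormedSpace ℝ 𝓑] [MeasurableSpace Ω] (M : SieveModel 𝒥 dx dz 𝓑 Ω)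

theorem fact_one_le_r : Fact (1 ≤ M.r) := ⟨one_le_two.trans M.two_le_r⟩

theorem card_moments (n : ℕ) : Fintype.card (Σ j, Fin (M.k n j)) = M.numMoments n := by
  simp [numMoments]

/-- The rescaled sample criterion and the population criterion agree on the sieve up to the
factor `C` and an additive error `Δ`. -/
def Comparable (P : ProbabilityMeasure (Obs 𝒥 dx dz)) (n : ℕ) (ω : Ω) (C Δ : ℝ) : Prop :=
  ∀ θ ∈ M.sieve n,
    (Real.sqrt n)⁻¹ * M.sampleCrit n ω θ ≤ C * (M.popCrit P n θ + Δ) ∧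
    M.popCrit P n θ ≤ C * ((Real.sqrt n)⁻¹ * M.sampleCrit n ω θ + Δ)

theorem popCrit_nonneg (P : ProbabilityMeasure (Obs 𝒥 dx dz)) (n : ℕ) (θ : 𝓑) :
    0 ≤ M.popCrit P n θ := by
  have := M.fact_one_le_r
  exact vecNorm_nonneg _

theorem scaledCrit_nonneg (n : ℕ) (ω : Ω) (θ : 𝓑) :
    0 ≤ (Real.sqrt n)⁻¹ * M.sampleCrit n ω θ := by
  have := M.fact_one_le_r
  exact mul_nonneg (inv_nonneg.2 (Real.sqrt_nonneg _)) (vecNorm_nonneg _)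

theorem sampleRate_nonneg {J B : ℕ → ℝ} {n : ℕ} (hJ : 0 ≤ J n) (hB : 0 ≤ B n) :
    0 ≤ M.sampleRate J B n := by
  unfold sampleRate
  positivity

/-- The vector of empirical processes of the moment functions. -/
def momentProc (P : ProbabilityMeasure (Obs 𝒥 dx dz)) (n : ℕ) (ω : Ω) (θ : 𝓑) :
    (Σ j, Fin (M.k n j)) → ℝ :=
  fun i => empProc (P : Measure (Obs 𝒥 dx dz)) M.V n (fun v => M.moment n θ v i) ω

theorem scaledCrit_eq (P : ProbabilityMeasure (Obs 𝒥 dx dz)) {n : ℕ} (hn : 1 ≤ n) (ω : Ω)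
    (θ : 𝓑) :
    (Real.sqrt n)⁻¹ * M.sampleCrit n ω θ = vecNorm M.r (M.Wt n ω *ᵥ
      ((fun i => ∫ v, M.moment n θ v i ∂(P : Measure (Obs 𝒥 dx dz)))
        + (Real.sqrt n)⁻¹ • M.momentProc P n ω θ)) := by
  have := M.fact_one_le_r
  have hs : (0 : ℝ) < Real.sqrt n := Real.sqrt_pos.2 (by exact_mod_cast hn)
  have hs' : 0 ≤ (Real.sqrt n)⁻¹ := inv_nonneg.2 hs.le
  unfold sampleCrit
  conv_lhs => rw [← abs_of_nonneg hs', ← vecNorm_smul, ← Matrix.mulVec_smul]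
  congr 2
  funext i
  simp only [Pi.smul_apply, Pi.add_apply, smul_eq_mul, momentProc, empProc_eq, Finset.sum_apply]
  rw [mul_sub, ← mul_assoc (Real.sqrt n)⁻¹ (Real.sqrt n), inv_mul_cancel₀ hs.ne']
  rw [abs_of_nonneg hs']
  ring

/-- The moment functions satisfy the maximal inequality at the rate `sampleRate`. -/
theorem measure_momentProc_le {J B : ℕ → ℝ} (h_iid : M.IIDSampling)
    (h_inst : M.BoundedInstruments B) (h_proc : M.ProcessRegular J) {n : ℕ} (hn : 1 ≤ n)
    (hk : 2 ≤ M.numMoments n) {P : ProbabilityMeasure (Obs 𝒥 dx dz)} (hP : P ∈ M.Pcl)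
    {K : ℝ} (hK : 2 ≤ K) :
    M.Pr P {ω | ∃ θ ∈ M.sieve n, 84 * K * M.sampleRate J B n
        < vecNorm M.r ((Real.sqrt n)⁻¹ • M.momentProc P n ω θ)} ≤ ENNReal.ofReal (42 / K) := by
  have hr := M.fact_one_le_r
  obtain ⟨hQ, hind, hmap⟩ := h_iid.2 P hP
  have hV : IsIIDSample (M.Pr P) M.V (P : Measure (Obs 𝒥 dx dz)) := ⟨h_iid.1, hind, hmap⟩
  obtain ⟨-, F, hF⟩ := h_proc
  obtain ⟨hFm, hFle, hF2, hJ0, hJ⟩ := hF n hn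
  obtain ⟨hB, hq⟩ := h_inst n hn
  have hFsq : Integrable (fun v => F n v ^ 2) (P : Measure (Obs 𝒥 dx dz)) := by
    refine (lintegral_ofReal_ne_top_iff_integrable (hFm.pow_const 2).aestronglyMeasurable
      (Eventually.of_forall fun v => sq_nonneg _)).1 (ne_top_of_lt (lt_of_le_of_lt ?_ hF2))
    exact le_iSup₂ (f := fun P' (_ : P' ∈ M.Pcl) =>
      ∫⁻ v, ENNReal.ofReal (F n v ^ 2) ∂(P' : Measure (Obs 𝒥 dx dz))) P hP
  have hFL : MemLp (F n) 2 (P : Measure (Obs 𝒥 dx dz)) :=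
    (memLp_two_iff_integrable_sq hFm.aestronglyMeasurable).2 hFsq
  have hmeas : ∀ f ∈ M.residualClass n, Measurable f := by
    rintro f ⟨j, θ, hθ, rfl⟩
    exact (M.measurable_ρ j θ (M.sieve_subset n hθ)).comp measurable_fst
  have hwm : ∀ i : Σ j, Fin (M.k n j),
      Measurable fun v : Obs 𝒥 dx dz => M.q n i.1 i.2 (v.2 i.1) := fun i =>
    (M.measurable_q n i.1 i.2).comp ((measurable_pi_apply i.1).comp measurable_snd)
  have hwB : ∀ i : Σ j, Fin (M.k n j), ∀ᵐ v ∂(P : Measure (Obs 𝒥 dx dz)),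
      |M.q n i.1 i.2 (v.2 i.1)| ≤ B n := fun i =>
    ae_abs_le_of_eLpNorm_top_le (zero_le_one.trans hB) (hq i.1 i.2 P hP)
  have hmain := hV.measure_exists_lt_abs_empProc_mul hn (I := Σ j, Fin (M.k n j))
    (by rw [M.card_moments]; exact hk) hmeas hFL hFle hwm hB hwB hJ0 (hJ P hP) hK
  refine (measure_mono fun ω hω => ?_).trans hmain
  simp only [Set.mem_ofPred_eq] at hω ⊢
  obtain ⟨θ, hθ, hlt⟩ := hω
  by_contra hcon
  push Not at hcon
  have hs : (0 : ℝ) < Real.sqrt n := Real.sqrt_pos.2 (by exact_mod_cast hn)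
  have hc0 : 0 ≤ 84 * K * (Real.sqrt (Real.log (Fintype.card (Σ j, Fin (M.k n j)))) * J n * B n) :=
    by positivity
  have h1 : vecNorm M.r (M.momentProc P n ω θ) ≤ _ := vecNorm_le_of_abs_le hc0 fun i =>
    hcon (fun v => M.ρ i.1 v.1 θ) ⟨i.1, θ, hθ, rfl⟩ i
  rw [vecNorm_smul, abs_of_pos (inv_pos.2 hs)] at hlt
  have h2 := mul_le_mul_of_nonneg_left h1 (inv_pos.2 hs).le
  rw [M.card_moments] at h2
  have h3 : (Real.sqrt n)⁻¹ * ((M.numMoments n : ℝ) ^ (1 / M.r).toReal *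
      (84 * K * (Real.sqrt (Real.log (M.numMoments n)) * J n * B n)))
      = 84 * K * M.sampleRate J B n := by
    unfold sampleRate
    field_simp
  linarith

/-- With probability arbitrarily close to one, uniformly over the distributions, the two criteria
are comparable up to a multiple of `sampleRate`. -/
theorem eventually_measure_not_comparable_le {J B : ℕ → ℝ} (h_iid : M.IIDSampling)
    (h_inst : M.BoundedInstruments B) (h_proc : M.ProcessRegular J) (h_weights : M.WeightsConverge)
    (hk : ∀ᶠ n in atTop, 2 ≤ M.numMoments n) :
    ∃ C : ℝ, 1 ≤ C ∧ ∀ ε : ℝ, 0 < ε → ∃ K : ℝ, 1 ≤ K ∧ ∀ᶠ n in atTop, ∀ P ∈ M.Pcl,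
      M.Pr P {ω | ¬ M.Comparable P n ω C (K * M.sampleRate J B n)} ≤ ENNReal.ofReal ε := by
  have hr := M.fact_one_le_r
  obtain ⟨S, hS, hSpd, C₀, hC₀⟩ := h_weights
  set C := max C₀ 1 with hC
  have hC1 : 1 ≤ C := le_max_right _ _
  refine ⟨2 * C, by linarith, fun ε hε => ?_⟩
  -- the maximal inequality and the weighting matrix may each fail with probability `ε / 2`
  set K := max 2 (84 / ε) with hKdef
  have hK2 : 2 ≤ K := le_max_left _ _
  have hKε : 42 / K ≤ ε / 2 := by
    have h1 : 84 / ε ≤ K := le_max_right _ _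
    rw [div_le_iff₀ hε] at h1
    rw [div_le_iff₀ (by linarith)]
    linarith
  refine ⟨84 * K, by linarith, ?_⟩
  have hw := (hS (1 / (2 * C)) (by positivity)).eventually_le_const
    (ENNReal.ofReal_pos.2 (half_pos hε))
  filter_upwards [hw, hk, eventually_ge_atTop 1] with n hwn hkn hn P hP
  have hJ0 : 0 ≤ J n := by
    obtain ⟨-, F, hF⟩ := h_proc
    exact (hF n hn).2.2.2.1
  have hΔ : 0 ≤ 84 * K * M.sampleRate J B n :=
    mul_nonneg (by linarith) (M.sampleRate_nonneg hJ0 (zero_le_one.trans (h_inst n hn).1))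
  have hproc := M.measure_momentProc_le h_iid h_inst h_proc hn hkn hP hK2
  have hwP := (le_iSup₂ (f := fun P' (_ : P' ∈ M.Pcl) =>
    M.Pr P' {ω | 1 / (2 * C) < matNorm M.r (M.Wt n ω - S n P')}) P hP).trans hwn
  refine (measure_mono (fun ω hω => ?_)).trans ((measure_union_le _ _).trans
    ((add_le_add hproc hwP).trans ?_))
  · by_contra hcon
    simp only [Set.mem_union, Set.mem_ofPred_eq, not_or, not_exists, not_and, not_lt] at hcon hω
    obtain ⟨hc1, hc2⟩ := hcon
    refine hω fun θ hθ => ?_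
    rw [M.scaledCrit_eq P hn]
    set mbar : (Σ j, Fin (M.k n j)) → ℝ :=
      fun i => ∫ v, M.moment n θ v i ∂(P : Measure (Obs 𝒥 dx dz)) with hmbar
    have hpop : M.popCrit P n θ = vecNorm M.r mbar := rfl
    rw [hpop]
    set G := (Real.sqrt n)⁻¹ • M.momentProc P n ω θ with hG
    have hGle := hc1 θ hθ
    have heq := vecNorm_mulVec_equiv hC1 ((hC₀ n hn P hP).1.trans (le_max_left _ _))
      (hSpd n hn P hP).2 ((hC₀ n hn P hP).2.trans (le_max_left _ _)) hc2 (mbar + G)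
    have t1 := vecNorm_add_le (r := M.r) mbar G
    have t2 := vecNorm_add_le (r := M.r) (mbar + G) (-G)
    rw [add_neg_cancel_right, vecNorm_neg] at t2
    constructor
    · exact heq.1.trans (mul_le_mul_of_nonneg_left (t1.trans (by linarith)) (by linarith))
    · nlinarith [heq.2]
  · rw [← ENNReal.ofReal_add (by positivity) (by positivity)]
    exact ENNReal.ofReal_le_ofReal (by linarith)

end SieveModel

/-! ### Rates of convergence on the event of comparability -/

namespace SieveModel

variable {𝒥 dx : ℕ} {dz : Fin 𝒥 → ℕ} {𝓑 Ω : Type*} [NormedAddCommGroup 𝓑]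
  [NormedSpace ℝ 𝓑] [MeasurableSpace Ω] {M : SieveModel 𝒥 dx dz 𝓑 Ω}
  {P : ProbabilityMeasure (Obs 𝒥 dx dz)} {n : ℕ} {ω : Ω} {C Δ z : ℝ} {τ : ℕ → ℝ}

theorem bddBelow_scaledCrit (M : SieveModel 𝒥 dx dz 𝓑 Ω) (n : ℕ) (ω : Ω) :
    BddBelow (Set.range fun θ : M.sieve n => (Real.sqrt n)⁻¹ * M.sampleCrit n ω θ) :=
  ⟨0, by rintro _ ⟨θ, rfl⟩; exact M.scaledCrit_nonneg n ω θ⟩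

/-- Near minimizers of the sample criterion have a small population criterion. -/
theorem Comparable.popCrit_le_of_mem_setEst (h : M.Comparable P n ω C Δ) (hC : 1 ≤ C)
    (hΔ : 0 ≤ Δ) (hz : 0 ≤ z) (hτ : 0 ≤ τ n)
    (hinf : ⨅ θ ∈ M.sieve n, ENNReal.ofReal (M.popCrit P n θ) ≤ ENNReal.ofReal z)
    {θ : 𝓑} (hθ : θ ∈ M.setEst τ n ω) :
    M.popCrit P n θ ≤ 2 * C ^ 2 * (z + Δ + τ n) := by
  obtain ⟨hs, hmin⟩ := hθ
  have hC0 : 0 < C := by linarith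
  have hI : (⨅ θ' : M.sieve n, (Real.sqrt n)⁻¹ * M.sampleCrit n ω θ') ≤ C * (z + Δ) := by
    refine le_of_forall_pos_le_add fun η hη => ?_
    have hlt : ⨅ θ ∈ M.sieve n, ENNReal.ofReal (M.popCrit P n θ)
        < ENNReal.ofReal (z + η / C) := by
      refine hinf.trans_lt ((ENNReal.ofReal_lt_ofReal_iff (by positivity)).2 ?_)
      have : 0 < η / C := by positivity
      linarith
    obtain ⟨θ', hθ', hlt'⟩ := by simpa only [iInf_lt_iff] using hlt
    have h1 := ((ENNReal.ofReal_lt_ofReal_iff (by positivity)).1 hlt').le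
    refine (ciInf_le (M.bddBelow_scaledCrit n ω) ⟨θ', hθ'⟩).trans ((h θ' hθ').1.trans ?_)
    refine (mul_le_mul_of_nonneg_left (add_le_add h1 le_rfl) hC0.le).trans (le_of_eq ?_)
    field_simp
    ring
  have h2 := (h θ hs).2
  have h3 : (Real.sqrt n)⁻¹ * M.sampleCrit n ω θ + Δ ≤ C * (z + Δ) + τ n + Δ := by linarith
  have h4 := h2.trans (mul_le_mul_of_nonneg_left h3 hC0.le)
  refine h4.trans ?_
  have hCC : C ≤ C ^ 2 := by nlinarith
  have h5 := mul_le_mul_of_nonneg_right hCC hΔ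
  have h6 := mul_le_mul_of_nonneg_right hCC hτ
  have h7 : 0 ≤ C ^ 2 * z := by positivity
  have h8 : 0 ≤ C ^ 2 * τ n := by positivity
  nlinarith

/-- Minimizers of the population criterion nearly minimize the sample criterion, if `τ` dominates
the sampling error. -/
theorem Comparable.popArgmin_subset_setEst (h : M.Comparable P n ω C Δ) (hC : 1 ≤ C)
    (hz : 0 ≤ z)
    (hinf : ⨅ θ ∈ M.sieve n, ENNReal.ofReal (M.popCrit P n θ) ≤ ENNReal.ofReal z)
    (hτ : C * (z + Δ) ≤ τ n) : M.popArgmin P n ⊆ M.setEst τ n ω := by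
  rintro θ ⟨hs, hmin⟩
  have h1 : M.popCrit P n θ ≤ z := by
    refine (ENNReal.ofReal_le_ofReal_iff hz).1 (le_trans ?_ hinf)
    exact le_iInf₂ fun θ' hθ' => ENNReal.ofReal_le_ofReal (hmin θ' hθ')
  have h2 : 0 ≤ ⨅ θ' : M.sieve n, (Real.sqrt n)⁻¹ * M.sampleCrit n ω θ' :=
    Real.iInf_nonneg fun θ' => M.scaledCrit_nonneg n ω θ'
  refine ⟨hs, ?_⟩
  have h3 := (h θ hs).1
  have h4 := mul_le_mul_of_nonneg_left (add_le_add h1 (le_refl Δ)) (by linarith : 0 ≤ C)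
  linarith

/-- Points of the sieve whose population criterion is small against the separation lie in the
neighbourhood of the minimizers. -/
theorem mem_nbhd_of_popCrit_le (hP : P ∈ M.nullSet) {θ : 𝓑} (hθ : θ ∈ M.sieve n) {ε a : ℝ}
    (hε : 0 < ε) (ha : M.popCrit P n θ ≤ a)
    (hsep : ENNReal.ofReal a ≤ ENNReal.ofReal (1 / 2) * M.separation n ε) :
    θ ∈ M.nbhd P n ε := by
  by_contra hcon
  have h0 := M.popCrit_nonneg P n θ
  have h1 : M.separation n ε ≤ ENNReal.ofReal (M.popCrit P n θ) :=
    (iInf₂_le P hP).trans (iInf₂_le θ ⟨hθ, hcon⟩)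
  have h2 : ENNReal.ofReal (M.popCrit P n θ)
      ≤ ENNReal.ofReal (1 / 2 * M.popCrit P n θ) := by
    rw [ENNReal.ofReal_mul (by norm_num)]
    exact (ENNReal.ofReal_le_ofReal ha).trans (hsep.trans (mul_le_mul_right h1 _))
  rw [ENNReal.ofReal_le_ofReal_iff (by linarith)] at h2
  -- the criterion vanishes at `θ`, which is therefore itself a minimizer
  have h3 : M.popCrit P n θ = 0 := by linarith
  refine hcon ⟨hθ, lt_of_le_of_lt (le_of_eq ?_) (ENNReal.ofReal_pos.2 hε)⟩
  refine dirHausdorff_eq_zero_of_subset (Set.singleton_subset_iff.2 ⟨hθ, fun θ' _ => ?_⟩)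
  rw [h3]
  exact M.popCrit_nonneg P n θ'

variable {𝓔 : Type*} [NormedAddCommGroup 𝓔] [NormedSpace ℝ 𝓔]

theorem toE_mono (ι : ∀ n, M.sieveSpan n →ₗ[ℝ] 𝓔) {A A' : Set 𝓑} (h : A ⊆ A') :
    M.toE ι n A ⊆ M.toE ι n A' :=
  Set.image_mono fun _ hb => h hb

theorem dirHausdorff_toE_le (ι : ∀ n, M.sieveSpan n →ₗ[ℝ] 𝓔) {A A' : Set 𝓑} {c : ℝ≥0∞}
    (h : ∀ θ ∈ A, dirHausdorff (M.toE ι n {θ}) (M.toE ι n A') ≤ c) :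
    dirHausdorff (M.toE ι n A) (M.toE ι n A') ≤ c := by
  refine iSup₂_le ?_
  rintro _ ⟨b, hb, rfl⟩
  refine le_trans ?_ (h b hb)
  exact le_iSup₂ (f := fun (a : 𝓔) (_ : a ∈ M.toE ι n {(b : 𝓑)}) =>
    ⨅ x ∈ M.toE ι n A', ENNReal.ofReal ‖a - x‖) (ι n b) ⟨b, rfl, rfl⟩

theorem iInf_popCrit_le {ζ : ℕ → ℝ} {J B : ℕ → ℝ} (h : M.Separated J B ζ) (hn : 1 ≤ n)
    (hP : P ∈ M.nullSet) :
    ⨅ θ ∈ M.sieve n, ENNReal.ofReal (M.popCrit P n θ) ≤ ENNReal.ofReal (ζ n) :=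
  (le_iSup₂ (f := fun P' (_ : P' ∈ M.nullSet) =>
    ⨅ θ ∈ M.sieve n, ENNReal.ofReal (M.popCrit P' n θ)) P hP).trans (h.2.2.1 n hn)

/-- On the event of comparability, every point of the set estimator is within a multiple of
`ν (sampleRate + ζ + τ)` of the population minimizers: separation brings it into the neighbourhood
where local identification converts the criterion into the distance. -/
theorem eventually_dirHausdorff_le (ι : ∀ n, M.sieveSpan n →ₗ[ℝ] 𝓔) {J B ζ ν : ℕ → ℝ}
    (hrate : ∀ n, 1 ≤ n → 0 ≤ M.sampleRate J B n)
    (h_sep : M.Separated J B ζ) (h_ident : M.LocallyIdentified ι ζ ν)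
    (hτ_nonneg : ∀ n, 1 ≤ n → 0 ≤ τ n)
    (hτ : ∀ ε : ℝ, 0 < ε → IsLittleOExt τ fun n => M.separation n ε) (hC : 1 ≤ C) {K : ℝ}
    (hK : 1 ≤ K) :
    ∃ A : ℝ, 0 < A ∧ ∀ᶠ n in atTop, ∀ P ∈ M.nullSet, ∀ ω,
      M.Comparable P n ω C (K * M.sampleRate J B n) →
      dirHausdorff (M.toE ι n (M.setEst τ n ω)) (M.toE ι n (M.popArgmin P n))
        ≤ ENNReal.ofReal (A * (M.rate J B ζ ν n + ν n * τ n)) := by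
  obtain ⟨-, hν, -, ε, hε, e, he, hid⟩ := h_ident
  obtain ⟨D, hD0, hD⟩ := he.exists_pos
  set A₀ := 2 * C ^ 2 * K with hA₀
  have hA₀pos : 0 < A₀ := by positivity
  refine ⟨A₀ + D, by positivity, ?_⟩
  have hc : 0 < 1 / (4 * A₀) := by positivity
  filter_upwards [h_sep.2.2.2 ε hε _ hc, hτ ε hε _ hc, hD.bound, eventually_ge_atTop 1]
    with n h1 h2 h3 hn P hP ω hcomp
  have hζ0 := h_sep.1 n hn
  have hR0 := hrate n hn
  have hτ0 := hτ_nonneg n hn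
  have hν0 := hν n hn
  refine dirHausdorff_toE_le ι fun θ hθ => ?_
  have hpop : M.popCrit P n θ ≤ A₀ * (ζ n + M.sampleRate J B n + τ n) := by
    refine (hcomp.popCrit_le_of_mem_setEst hC (mul_nonneg (by linarith) hR0) hζ0 hτ0
      (iInf_popCrit_le h_sep hn hP) hθ).trans ?_
    rw [hA₀, mul_assoc (2 * C ^ 2) K]
    refine mul_le_mul_of_nonneg_left ?_ (by positivity)
    nlinarith
  have hnb : θ ∈ M.nbhd P n ε := by
    refine mem_nbhd_of_popCrit_le hP hθ.1 hε hpop ?_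
    rw [ENNReal.ofReal_mul hA₀pos.le, ENNReal.ofReal_add (by positivity) hτ0]
    refine (mul_le_mul_right (add_le_add h1 h2) _).trans (le_of_eq ?_)
    rw [← two_mul, ← mul_assoc, ← mul_assoc, ← ENNReal.ofReal_ofNat 2,
      ← ENNReal.ofReal_mul hA₀pos.le, ← ENNReal.ofReal_mul (by positivity)]
    congr 2
    field_simp
    norm_num
  have hd := hid n hn P hP θ hnb
  have hele : e n ≤ D * ζ n := by
    rw [Real.norm_eq_abs, Real.norm_eq_abs, abs_of_nonneg hζ0] at h3
    exact (le_abs_self _).trans h3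
  have hsum : M.popCrit P n θ + e n ≤ (A₀ + D) * (ζ n + M.sampleRate J B n + τ n) := by
    have : D * ζ n ≤ D * (ζ n + M.sampleRate J B n + τ n) :=
      mul_le_mul_of_nonneg_left (by linarith) hD0.le
    linarith
  have hd2 := hd.trans (ENNReal.ofReal_le_ofReal hsum)
  rw [ENNReal.ofReal_inv_of_pos hν0, ENNReal.inv_mul_le_iff
    (ENNReal.ofReal_pos.2 hν0).ne' ENNReal.ofReal_ne_top, ← ENNReal.ofReal_mul hν0.le] at hd2
  refine hd2.trans (ENNReal.ofReal_le_ofReal (le_of_eq ?_))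
  unfold rate
  ring

end SieveModel

end

theorem mainTheorem5 {𝒥 dx : ℕ} {dz : Fin 𝒥 → ℕ} {𝓑 𝓔 Ω : Type*}
    [NormedAddCommGroup 𝓑] [NormedSpace ℝ 𝓑] [CompleteSpace 𝓑]
    [NormedAddCommGroup 𝓔] [NormedSpace ℝ 𝓔] [CompleteSpace 𝓔] [MeasurableSpace Ω]
    (M : SieveModel 𝒥 dx dz 𝓑 Ω) (ι : ∀ n, M.sieveSpan n →ₗ[ℝ] 𝓔) (J B ζ ν τ : ℕ → ℝ)
    (hk : ∀ᶠ n in atTop, 2 ≤ M.numMoments n)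
    (h_iid : M.IIDSampling)
    (h_inst : M.BoundedInstruments B)
    (h_proc : M.ProcessRegular J)
    (h_weights : M.WeightsConverge)
    (h_sep : M.Separated J B ζ)
    (h_ident : M.LocallyIdentified ι ζ ν)
    (hτ_nonneg : ∀ n, 1 ≤ n → 0 ≤ τ n)
    (hτ : ∀ ε : ℝ, 0 < ε → IsLittleOExt τ fun n => M.separation n ε) :
    UniformBigOp M.nullSet M.Pr
      (fun n P ω => dirHausdorff (M.toE ι n (M.setEst τ n ω)) (M.toE ι n (M.popArgmin P n)))
      (fun n => M.rate J B ζ ν n + ν n * τ n) ∧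
    ((fun n => M.sampleRate J B n + ζ n) =o[atTop] τ →
      UniformBigOp M.nullSet M.Pr
        (fun n P ω => hausdorff (M.toE ι n (M.setEst τ n ω)) (M.toE ι n (M.popArgmin P n)))
        (fun n => M.rate J B ζ ν n + ν n * τ n)) := by
  have hrate : ∀ n, 1 ≤ n → 0 ≤ M.sampleRate J B n := fun n hn => by
    obtain ⟨-, F, hF⟩ := h_proc
    exact M.sampleRate_nonneg (hF n hn).2.2.2.1 (zero_le_one.trans (h_inst n hn).1)
  obtain ⟨C, hC, hprob⟩ :=
    M.eventually_measure_not_comparable_le h_iid h_inst h_proc h_weights hk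
  constructor
  · intro ε hε
    obtain ⟨K, hK, hev⟩ := hprob ε hε
    obtain ⟨A, hA, hdist⟩ :=
      SieveModel.eventually_dirHausdorff_le ι hrate h_sep h_ident hτ_nonneg hτ hC hK
    refine ⟨A, hA, ?_⟩
    filter_upwards [hev, hdist] with n h1 h2
    refine iSup₂_le fun P hP => (measure_mono fun ω hω => ?_).trans (h1 P hP.1)
    simp only [Set.mem_ofPred_eq] at hω ⊢
    exact fun hcomp => absurd (h2 P hP ω hcomp) (not_le.2 hω)
  · intro ho ε hε
    obtain ⟨K, hK, hev⟩ := hprob ε hε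
    obtain ⟨A, hA, hdist⟩ :=
      SieveModel.eventually_dirHausdorff_le ι hrate h_sep h_ident hτ_nonneg hτ hC hK
    refine ⟨A, hA, ?_⟩
    have hCK : 0 < 1 / (C * K) := by positivity
    filter_upwards [hev, hdist, ho.bound hCK, eventually_ge_atTop 1] with n h1 h2 h3 hn
    refine iSup₂_le fun P hP => (measure_mono fun ω hω => ?_).trans (h1 P hP.1)
    simp only [Set.mem_ofPred_eq] at hω ⊢
    refine fun hcomp => absurd (max_le (h2 P hP ω hcomp) ?_) (not_le.2 hω)
    have hζ0 := h_sep.1 n hn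
    have hR0 := hrate n hn
    have hτle : C * (ζ n + K * M.sampleRate J B n) ≤ τ n := by
      rw [Real.norm_eq_abs, Real.norm_eq_abs, abs_of_nonneg (by linarith),
        abs_of_nonneg (hτ_nonneg n hn), one_div, inv_mul_eq_div, le_div_iff₀ (by positivity)] at h3
      have h4 : ζ n ≤ K * ζ n := le_mul_of_one_le_left hζ0 hK
      nlinarith
    rw [dirHausdorff_eq_zero_of_subset (SieveModel.toE_mono ι (hcomp.popArgmin_subset_setEst hC hζ0
      (SieveModel.iInf_popCrit_le h_sep hn hP) hτle))]
    exact zero_le
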